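/- Let $(M,\omega)$ be a compact connected Kähler manifold of complex dimension $n$ with Liouville measure $\Omega=\frac1{n!}\omega^{n}$. Let $(L,h)$ be a quantum line bundle on it, i.e. a holomorphic line bundle with a smooth Hermitian metric $h$ such that $\mathrm{i}\,\overline{\partial}\partial\log\hat h=\omega$, where $\hat h=h(e,e)$ for any local holomorphic frame $e$. Assume that $L$ is very ample. Fix an integer $m\ge 0$, write $L^m=L^{\otimes m}$ with the induced metric $h^{(m)}$, and let $\langle s,t\rangle=\int_M h^{(m)}(s,t)\,\Omega$ (antilinear in the first argument) be the scalar product on the smooth sections of $L^m$. The space $\Gamma_{hol}(M,L^m)$ of global holomorphic sections of $L^m$ is finite-dimensional. For a smooth function $f:M\to\mathbb{C}$, the Toeplitz operator on $\Gamma_{hol}(M,L^m)$ is $T_f^{(m)}s=\Pi^{(m)}(f s)$, where $\Pi^{(m)}$ is the orthogonal projection onto $\Gamma_{hol}(M,L^m)$. For $x\in M$ and $0\neq\alpha\in L_x^*$ let $e_\alpha^{(m)}\in\Gamma_{hol}(M,L^m)$ be the coherent vector, determined by $\langle e_\alpha^{(m)},s\rangle=\alpha^{\otimes m}(s(x))$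 for all $s\in\Gamma_{hol}(M,L^m)$. Put $$P_x^{(m)}s=\frac{\langle e_\alpha^{(m)},s\rangle}{\langle e_\alpha^{(m)},e_\alpha^{(m)}\rangle}\,e_\alpha^{(m)},\qquad \epsilon^{(m)}(x)=\frac{h^{(m)}(e_\alpha^{(m)},e_\alpha^{(m)})(x)}{\langle e_\alpha^{(m)},e_\alpha^{(m)}\rangle},\qquad \Omega_\epsilon^{(m)}=\epsilon^{(m)}\,\Omega ;$$ these do not depend on the choice of $\alpha$. A function $f\in C^\infty(M)$ is called a contravariant Berezin symbol of $A\in\mathrm{End}(\Gamma_{hol}(M,L^m))$ if $$A=\int_M f(x)\,P_x^{(m)}\,\Omega_\epsilon^{(m)}(x).$$ Proposition 5.5. For every $f\in C^\infty(M)$, $$T_f^{(m)}=\int_M f(x)\,P_x^{(m)}\,\Omega_\epsilon^{(m)}(x),$$ i.e. $f$ is a contravariant symbol of the Toeplitz operator $T_f^{(m)}$. Moreover, every operator $A\in\mathrm{End}(\Gamma_{hol}(M,L^m))$ has a contravariant symbol $f\in C^\infty(M)$. -/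

import Mathlib

open scoped Manifold ContDiff Topology TensorProduct ComplexConjugate ComplexOrder
open Bundle MeasureTheory

noncomputable section

namespace BerezinToeplitz

/-- The model space `ℂⁿ` of an `n`-dimensional complex manifold. -/
abbrev Cn (n : ℕ) : Type := Fin n → ℂ

/-! ### Real (1,1)-forms on `ℂⁿ` and their coefficient matrices -/

section posdef
variable {n : ℕ}

/-- The coefficients `g_{jk}` of a real alternating 2-form `η` of type (1,1) on `ℂⁿ`, that is
`η = i ∑ g_{jk} dz_j ∧ dz̄_k`. Such an `η` is `η(u,v) = -2 Im G(u,v)` for the Hermitian form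
`G(u,v) = ∑ g_{jk} u_j conj(v_k)`, so that `G(u,v) = (η(u,iv) - i η(u,v)) / 2`. -/
def hermCoeff (η : (Cn n) [⋀^Fin 2]→L[ℝ] ℝ) : Matrix (Fin n) (Fin n) ℂ := fun j k =>
  (((η ![Pi.single j 1, Complex.I • Pi.single k 1] : ℝ) : ℂ)
    - Complex.I * ((η ![Pi.single j 1, Pi.single k 1] : ℝ) : ℂ)) / 2

variable (η : (Cn n) [⋀^Fin 2]→L[ℝ] ℝ)

theorem form_add_left (u v w : Cn n) : η ![u + v, w] = η ![u, w] + η ![v, w] := by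
  exact η.toContinuousMultilinearMap.toMultilinearMap.cons_add ![w] u v

theorem form_smul_left (c : ℝ) (u w : Cn n) : η ![c • u, w] = c * η ![u, w] := by
  exact η.toContinuousMultilinearMap.toMultilinearMap.cons_smul ![w] c u

theorem form_swap (u w : Cn n) : η ![u, w] = - η ![w, u] := by
  have := η.toAlternatingMap.map_swap ![w, u] (i := 0) (j := 1) (by decide)
  rw [← ContinuousAlternatingMap.coe_toAlternatingMap, ← this]
  congr 1
  ext i
  fin_cases i <;> simp

theorem form_add_right (u v w : Cn n) : η ![w, u + v] = η ![w, u] + η ![w, v] := by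
  rw [form_swap, form_add_left, form_swap η u, form_swap η v]; ring

theorem form_smul_right (c : ℝ) (u w : Cn n) : η ![w, c • u] = c * η ![w, u] := by
  rw [form_swap, form_smul_left, form_swap η u]; ring

/-- The coefficient matrix of a positive (1,1)-form is Hermitian and positive definite. -/
theorem hermCoeff_posDef
    (h11 : ∀ u v : Cn n, η ![Complex.I • u, Complex.I • v] = η ![u, v])
    (hpos : ∀ u : Cn n, u ≠ 0 → 0 < η ![u, Complex.I • u]) : (hermCoeff η).PosDef := by
  have hI : ∀ u v : Cn n, η ![Complex.I • u, v] = - η ![u, Complex.I • v] := by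
    intro u v
    rw [← h11 u (Complex.I • v), smul_smul, Complex.I_mul_I, neg_one_smul]
    have := form_smul_right η (-1) v (Complex.I • u)
    simp only [neg_smul, one_smul] at this
    rw [this]; ring
  have hsm : ∀ (c : ℂ) (u : Cn n), c • u = c.re • u + c.im • (Complex.I • u) := by
    intro c u
    ext i
    simp only [Pi.smul_apply, Pi.add_apply, smul_eq_mul, Complex.real_smul]
    conv_lhs => rw [← Complex.re_add_im c]
    ring
  let G : Cn n →ₗ[ℂ] Cn n →ₗ⋆[ℂ] ℂ := LinearMap.mk₂'ₛₗ (RingHom.id ℂ) (starRingEnd ℂ)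
    (fun u v => (((η ![u, Complex.I • v] : ℝ) : ℂ) - Complex.I * ((η ![u, v] : ℝ) : ℂ)) / 2)
    (by intro u v w; simp only [form_add_left]; push_cast; ring)
    (by
      intro c u v
      have e1 : η ![c • u, v] = c.re * η ![u, v] - c.im * η ![u, Complex.I • v] := by
        rw [hsm, form_add_left, form_smul_left, form_smul_left, hI]; ring
      have e2 : η ![c • u, Complex.I • v] =
          c.re * η ![u, Complex.I • v] + c.im * η ![u, v] := by
        rw [hsm, form_add_left, form_smul_left, form_smul_left, h11]
      simp only [e1, e2, RingHom.id_apply, smul_eq_mul]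
      apply Complex.ext <;> simp <;> ring)
    (by intro u v w; simp only [smul_add, form_add_right]; push_cast; ring)
    (by
      intro c u v
      have hII : η ![u, Complex.I • Complex.I • v] = - η ![u, v] := by
        rw [smul_smul, Complex.I_mul_I]
        have := form_smul_right η (-1) v u
        simp only [neg_smul, one_smul] at this ⊢
        rw [this]; ring
      have e1 : η ![u, c • v] = c.re * η ![u, v] + c.im * η ![u, Complex.I • v] := by
        rw [hsm, form_add_right, form_smul_right, form_smul_right]
      have e2 : η ![u, Complex.I • c • v] =
          c.re * η ![u, Complex.I • v] - c.im * η ![u, v] := by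
        rw [smul_comm, hsm, form_add_right, form_smul_right, form_smul_right, hII]; ring
      simp only [e1, e2, smul_eq_mul]
      apply Complex.ext <;> simp <;> ring)
  have hG : ∀ j k, hermCoeff η j k = G (Pi.single j 1) (Pi.single k 1) := fun j k => rfl
  have hGapp : ∀ u v, G u v =
    (((η ![u, Complex.I • v] : ℝ) : ℂ) - Complex.I * ((η ![u, v] : ℝ) : ℂ)) / 2 := fun _ _ => rfl
  have hGsymm : ∀ u v, conj (G u v) = G v u := by
    intro u v
    rw [hGapp, hGapp, form_swap η v (Complex.I • u), hI, form_swap η v u]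
    rw [map_div₀, map_ofNat]
    apply Complex.ext <;> simp
  refine Matrix.PosDef.of_dotProduct_mulVec_pos ?_ ?_
  · ext j k
    rw [Matrix.conjTranspose_apply, hG, hG]
    exact hGsymm _ _
  · intro x hx
    have hx' : star x ≠ 0 := by simpa using hx
    have key : star x ⬝ᵥ (hermCoeff η).mulVec x = G (star x) (star x) := by
      have hs : star x = ∑ j, (star x) j • (Pi.single j (1 : ℂ) : Cn n) := by
        ext i; simp [Finset.sum_apply, Pi.single_apply]
      conv_rhs => rw [hs]
      simp only [map_sum, LinearMap.sum_apply, map_smul, LinearMap.smul_apply,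
        LinearMap.map_smulₛₗ, dotProduct, Matrix.mulVec, hG, Finset.mul_sum, smul_eq_mul]
      rw [Finset.sum_comm]
      refine (Finset.sum_congr rfl fun j _ => Finset.sum_congr rfl fun k _ => ?_)
      simp
      ring
    rw [key, hGapp]
    have h0 : η ![star x, star x] = 0 := by
      have := form_swap η (star x) (star x); linarith
    rw [h0]
    have := hpos _ hx'
    simp only [Complex.ofReal_zero, mul_zero, sub_zero]
    rw [show ((η ![star x, Complex.I • star x] : ℝ) : ℂ) / 2 =
      ((η ![star x, Complex.I • star x] / 2 : ℝ) : ℂ) by push_cast; rfl]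
    exact_mod_cast half_pos this

end posdef

/-! ### Kähler forms and the Liouville measure -/

variable {n : ℕ} {M : Type*} [TopologicalSpace M] [ChartedSpace (Cn n) M]

/-- The differential at `z` of the inverse of the chart `e`: it sends the standard basis vectors to
the coordinate vector fields. -/
def chartFrame (e : OpenPartialHomeomorph M (Cn n)) (z : Cn n) :
    Cn n →L[ℂ] TangentSpace 𝓘(ℂ, Cn n) (e.symm z) :=
  mfderiv 𝓘(ℂ, Cn n) 𝓘(ℂ, Cn n) e.symm z

/-- The expression in the chart `e` of a field of real alternating 2-forms (its pullback under
`e.symm`). -/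
def chartForm (κ : ∀ x : M, (TangentSpace 𝓘(ℂ, Cn n) x) [⋀^Fin 2]→L[ℝ] ℝ)
    (e : OpenPartialHomeomorph M (Cn n)) (z : Cn n) : (Cn n) [⋀^Fin 2]→L[ℝ] ℝ :=
  (κ (e.symm z)).compContinuousLinearMap
    ((chartFrame e z).restrictScalars ℝ)

variable (n M) in
/-- A Kähler form on the `n`-dimensional complex manifold `M`: a smooth, closed, positive real
2-form of type (1,1). The complex structure `J` of a tangent space is multiplication by `i`, type
(1,1) means invariance under `J`, and positivity means `κ(u, Ju) > 0` for `u ≠ 0`. -/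
structure KaehlerForm where
  /-- the 2-form on each tangent space -/
  toFun : ∀ x : M, (TangentSpace 𝓘(ℂ, Cn n) x) [⋀^Fin 2]→L[ℝ] ℝ
  smooth : ∀ e ∈ atlas (Cn n) M, ContDiffOn ℝ ∞ (chartForm toFun e) e.target
  closed : ∀ e ∈ atlas (Cn n) M, ∀ z ∈ e.target, extDeriv (chartForm toFun e) z = 0
  typeOneOne : ∀ (x : M) (u v : TangentSpace 𝓘(ℂ, Cn n) x),
    toFun x ![Complex.I • u, Complex.I • v] = toFun x ![u, v]
  positive : ∀ (x : M) (u : TangentSpace 𝓘(ℂ, Cn n) x), u ≠ 0 →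
    0 < toFun x ![u, Complex.I • u]

namespace KaehlerForm

/-- The matrix `g_{jk}` with `κ = i ∑ g_{jk} dz_j ∧ dz̄_k` in the holomorphic coordinates `e`. -/
def coeff (κ : KaehlerForm n M) (e : OpenPartialHomeomorph M (Cn n)) (z : Cn n) :
    Matrix (Fin n) (Fin n) ℂ := hermCoeff (chartForm κ.toFun e z)

/-- The density of the Liouville form `κⁿ / n!` with respect to Lebesgue measure in the holomorphic
coordinates `e`. As `i dz ∧ dz̄ = 2 dx ∧ dy`, it is `2ⁿ det g`. -/
def density (κ : KaehlerForm n M) (e : OpenPartialHomeomorph M (Cn n)) (z : Cn n) : ℝ :=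
  2 ^ n * (κ.coeff e z).det.re

/-- The measure on the domain of the chart `e` given by the Liouville form `κⁿ / n!`. -/
def localMeasure [MeasurableSpace M] (κ : KaehlerForm n M)
    (e : OpenPartialHomeomorph M (Cn n)) : Measure M :=
  (((volume : Measure (Cn n)).restrict e.target).withDensity
    (fun z => ENNReal.ofReal (κ.density e z))).map e.symm

theorem chartForm_apply (κ : KaehlerForm n M) (e : OpenPartialHomeomorph M (Cn n)) (z u v : Cn n) :
    chartForm κ.toFun e z ![u, v] =
      κ.toFun (e.symm z) ![chartFrame e z u, chartFrame e z v] := by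
  rw [chartForm, ContinuousAlternatingMap.compContinuousLinearMap_apply]
  congr 1
  ext i : 1
  fin_cases i <;> rfl

theorem coeff_posDef [IsManifold 𝓘(ℂ, Cn n) ω M] (κ : KaehlerForm n M)
    {e : OpenPartialHomeomorph M (Cn n)} (he : e ∈ atlas (Cn n) M) {z : Cn n}
    (hz : z ∈ e.target) : (κ.coeff e z).PosDef := by
  have : IsManifold 𝓘(ℂ, Cn n) 1 M := IsManifold.of_le (n := ω) le_top
  refine hermCoeff_posDef _ ?_ ?_
  · intro u v
    rw [chartForm_apply, chartForm_apply, map_smul, map_smul]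
    exact κ.typeOneOne _ _ _
  · intro u hu
    rw [chartForm_apply, map_smul]
    refine κ.positive _ _ ?_
    have hinj := (mdifferentiable_of_mem_atlas (I := 𝓘(ℂ, Cn n)) he).symm.mfderiv_injective hz
    intro h0
    exact hu (hinj (h0.trans (map_zero _).symm))

theorem density_pos [IsManifold 𝓘(ℂ, Cn n) ω M] (κ : KaehlerForm n M)
    {e : OpenPartialHomeomorph M (Cn n)} (he : e ∈ atlas (Cn n) M) {z : Cn n}
    (hz : z ∈ e.target) : 0 < κ.density e z :=
  mul_pos (by positivity) (Complex.pos_iff.1 (κ.coeff_posDef he hz).det_pos).1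

theorem density_continuousOn (κ : KaehlerForm n M)
    {e : OpenPartialHomeomorph M (Cn n)} (he : e ∈ atlas (Cn n) M) :
    ContinuousOn (κ.density e) e.target := by
  have h := (κ.smooth e he).continuousOn
  have h1 : ∀ v : Fin 2 → Cn n, ContinuousOn (fun z => chartForm κ.toFun e z v) e.target :=
    fun v => (continuous_eval_const v).comp_continuousOn h
  have h2 : ContinuousOn (κ.coeff e) e.target := by
    refine continuousOn_pi.2 fun j => continuousOn_pi.2 fun k => ?_
    have := h1
    simp only [coeff, hermCoeff]
    exact (((Complex.continuous_ofReal.comp_continuousOn (h1 _)).sub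
      (continuousOn_const.mul (Complex.continuous_ofReal.comp_continuousOn (h1 _)))).div_const _)
  exact continuousOn_const.mul (Complex.continuous_re.comp_continuousOn
    ((Continuous.matrix_det continuous_id).comp_continuousOn h2))

theorem aemeasurable_symm [MeasurableSpace M] [BorelSpace M] (κ : KaehlerForm n M)
    {e : OpenPartialHomeomorph M (Cn n)} :
    AEMeasurable e.symm (((volume : Measure (Cn n)).restrict e.target).withDensity
    (fun z => ENNReal.ofReal (κ.density e z))) :=
  (e.continuousOn_symm.aemeasurable e.open_target.measurableSet).mono_ac
    (withDensity_absolutelyContinuous _ _)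

end KaehlerForm

section
variable [CompactSpace M] [T2Space M]
variable (n M) in
theorem exists_chartPartition : ∃ ρ : PartitionOfUnity M M Set.univ,
    ρ.IsSubordinate fun x => (chartAt (Cn n) x).source :=
  PartitionOfUnity.exists_isSubordinate isClosed_univ _ (fun x => (chartAt (Cn n) x).open_source)
    fun x _ => Set.mem_iUnion.2 ⟨x, mem_chart_source (Cn n) x⟩

variable (n M) in
/-- A partition of unity subordinate to the cover of `M` by its preferred charts. -/
def chartPartition : PartitionOfUnity M M Set.univ := (exists_chartPartition n M).choose

/-- The Liouville measure `Ω = κⁿ / n!` of a compact Kähler manifold: as usual for the integral of a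
volume form, `∫ f Ω = ∑ ∫ ρ_x f Ω` with a partition of unity `ρ_x` subordinate to coordinate
charts, where each summand is evaluated in the chart (the result does not depend on the choice). -/
def KaehlerForm.liouville [MeasurableSpace M] (κ : KaehlerForm n M) : Measure M :=
  Measure.sum fun x : M => (κ.localMeasure (chartAt (Cn n) x)).withDensity
    fun y => ENNReal.ofReal (chartPartition n M x y)

variable [MeasurableSpace M] [BorelSpace M]

theorem KaehlerForm.localMeasure_lt_top (κ : KaehlerForm n M)
    {e : OpenPartialHomeomorph M (Cn n)} (he : e ∈ atlas (Cn n) M) {K : Set M} (hK : IsCompact K)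
    (hKe : K ⊆ e.source) : κ.localMeasure e K < ⊤ := by
  rw [localMeasure, Measure.map_apply_of_aemeasurable κ.aemeasurable_symm hK.measurableSet]
  set ν := ((volume : Measure (Cn n)).restrict e.target).withDensity
    (fun z => ENNReal.ofReal (κ.density e z))
  have hc : IsCompact (e '' K) := hK.image_of_continuousOn (e.continuousOn.mono hKe)
  have hct : e '' K ⊆ e.target := by
    rintro _ ⟨y, hy, rfl⟩; exact e.map_source (hKe hy)
  have hsub : e.symm ⁻¹' K ⊆ e '' K ∪ e.targetᶜ := by
    intro z hz
    by_cases h : z ∈ e.target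
    · exact Or.inl ⟨e.symm z, hz, e.right_inv h⟩
    · exact Or.inr h
  have h0 : ν e.targetᶜ = 0 := by
    refine withDensity_absolutelyContinuous _ _ ?_
    rw [Measure.restrict_apply e.open_target.measurableSet.compl]
    simp
  obtain ⟨C, hC⟩ := (hc.image_of_continuousOn ((κ.density_continuousOn he).mono hct)).bddAbove
  calc ν (e.symm ⁻¹' K) ≤ ν (e '' K) + ν e.targetᶜ :=
        (measure_mono hsub).trans (measure_union_le _ _)
    _ = ν (e '' K) := by rw [h0, add_zero]
    _ = ∫⁻ z in e '' K, ENNReal.ofReal (κ.density e z) ∂(volume.restrict e.target) :=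
        withDensity_apply _ hc.measurableSet
    _ ≤ ∫⁻ z in e '' K, ENNReal.ofReal C ∂(volume.restrict e.target) :=
        setLIntegral_mono' hc.measurableSet fun z hz =>
          ENNReal.ofReal_le_ofReal (hC ⟨z, hz, rfl⟩)
    _ < ⊤ := by
        rw [setLIntegral_const]
        exact ENNReal.mul_lt_top ENNReal.ofReal_lt_top
          ((Measure.restrict_apply_le _ _).trans_lt hc.measure_lt_top)

instance KaehlerForm.isFiniteMeasure_liouville (κ : KaehlerForm n M) :
    IsFiniteMeasure κ.liouville := by
  constructor
  set ρ := chartPartition n M with hρ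
  have hsub : ρ.IsSubordinate fun x => (chartAt (Cn n) x).source :=
    (exists_chartPartition n M).choose_spec
  have hfin : {x : M | (Function.support (ρ x)).Nonempty}.Finite :=
    ρ.locallyFinite.finite_nonempty_of_compact
  rw [liouville, Measure.sum_apply _ MeasurableSet.univ]
  rw [tsum_eq_sum (s := hfin.toFinset)]
  · refine ENNReal.sum_lt_top.2 fun x _ => ?_
    rw [withDensity_apply _ MeasurableSet.univ, Measure.restrict_univ]
    have hK : IsCompact (tsupport (ρ x)) := (isClosed_tsupport _).isCompact
    refine lt_of_le_of_lt ?_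
      (κ.localMeasure_lt_top (chart_mem_atlas (Cn n) x) hK (hsub x))
    rw [← lintegral_indicator_one hK.measurableSet]
    refine lintegral_mono fun y => ?_
    by_cases hy : y ∈ tsupport (ρ x)
    · simpa [hy] using ρ.le_one x y
    · simp [hy, ← hρ, image_eq_zero_of_notMem_tsupport hy]
  · intro x hx
    have : ∀ y, ρ x y = 0 := by
      intro y
      by_contra h
      exact hx (hfin.mem_toFinset.2 ⟨y, h⟩)
    simp [← hρ, this]

instance KaehlerForm.isOpenPosMeasure_liouville [IsManifold 𝓘(ℂ, Cn n) ω M]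
    (κ : KaehlerForm n M) : κ.liouville.IsOpenPosMeasure := by
  constructor
  rintro U hU ⟨y, hy⟩ h0
  set ρ := chartPartition n M with hρ
  have hsub : ρ.IsSubordinate fun x => (chartAt (Cn n) x).source :=
    (exists_chartPartition n M).choose_spec
  obtain ⟨x, hx⟩ := ρ.exists_pos (Set.mem_univ y)
  set e := chartAt (Cn n) x
  rw [liouville, Measure.sum_apply _ hU.measurableSet, ENNReal.tsum_eq_zero] at h0
  have h1 := h0 x
  have hρm : Measurable fun y => ENNReal.ofReal (ρ x y) :=
    ENNReal.measurable_ofReal.comp (ρ x).continuous.measurable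
  rw [withDensity_apply_eq_zero hρm] at h1
  set V := {y | ENNReal.ofReal (ρ x y) ≠ 0} ∩ U with hV
  have hVo : IsOpen V := by
    have : {y | ENNReal.ofReal (ρ x y) ≠ 0} = {y | 0 < ρ x y} := by
      ext y; simp
    rw [hV, this]
    exact (isOpen_lt continuous_const (ρ x).continuous).inter hU
  have hyV : y ∈ V := ⟨by simpa using hx, hy⟩
  have hye : y ∈ e.source := hsub x (subset_tsupport _ (ne_of_gt hx))
  change κ.localMeasure e V = 0 at h1
  have hdm : AEMeasurable (fun z => ENNReal.ofReal (κ.density e z))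
      ((volume : Measure (Cn n)).restrict e.target) :=
    ENNReal.measurable_ofReal.comp_aemeasurable
      ((κ.density_continuousOn (chart_mem_atlas (Cn n) x)).aemeasurable
        e.open_target.measurableSet)
  rw [localMeasure, Measure.map_apply_of_aemeasurable κ.aemeasurable_symm hVo.measurableSet,
    withDensity_apply_eq_zero' hdm] at h1
  have h2 : ((volume : Measure (Cn n)).restrict e.target) (e.target ∩ e.symm ⁻¹' V) = 0 := by
    refine measure_mono_null ?_ h1
    rintro z ⟨hz, hzV⟩
    refine ⟨?_, hzV⟩
    simpa using κ.density_pos (chart_mem_atlas (Cn n) x) hz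
  have hWo : IsOpen (e.target ∩ e.symm ⁻¹' V) := e.isOpen_inter_preimage_symm hVo
  rw [Measure.restrict_apply hWo.measurableSet] at h2
  refine (hWo.inter e.open_target).measure_ne_zero volume ⟨e y, ⟨⟨e.map_source hye, ?_⟩,
    e.map_source hye⟩⟩ h2
  simpa [e.left_inv hye] using hyV

end


/-! ### Line bundles and their tensor powers -/

section tensor
variable {V : Type*} [AddCommGroup V] [Module ℂ V]

/-- For a linear form `α` on `V`, the linear form `α^{⊗m}` on `V^{⊗m}`, determined by
`α^{⊗m}(v₁ ⊗ ⋯ ⊗ vₘ) = α(v₁) ⋯ α(vₘ)`. -/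
def tensorEval (α : Module.Dual ℂ V) (m : ℕ) : ⨂[ℂ]^m V →ₗ[ℂ] ℂ :=
  PiTensorProduct.lift ((MultilinearMap.mkPiAlgebra ℂ (Fin m) ℂ).compLinearMap fun _ => α)

theorem tensorEval_tprod (α : Module.Dual ℂ V) (m : ℕ) (v : Fin m → V) :
    tensorEval α m (PiTensorProduct.tprod ℂ v) = ∏ i, α (v i) := by
  simp [tensorEval]

theorem tensorEval_smul (c : ℂ) (α : Module.Dual ℂ V) (m : ℕ) :
    tensorEval (c • α) m = c ^ m • tensorEval α m := by
  refine PiTensorProduct.ext (MultilinearMap.ext fun v => ?_)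
  simp [tensorEval_tprod, Finset.prod_mul_distrib]

theorem tensorEval_injective (m : ℕ) (α : V ≃ₗ[ℂ] ℂ) :
    Function.Injective (tensorEval (α : Module.Dual ℂ V) m) := by
  have key : ∀ u : ⨂[ℂ]^m V, u = tensorEval (α : Module.Dual ℂ V) m u •
      PiTensorProduct.tprod ℂ (fun _ : Fin m => α.symm 1) := by
    intro u
    have : (LinearMap.id : ⨂[ℂ]^m V →ₗ[ℂ] ⨂[ℂ]^m V) =
        (tensorEval (α : Module.Dual ℂ V) m).smulRight
          (PiTensorProduct.tprod ℂ (fun _ : Fin m => α.symm 1)) := by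
      refine PiTensorProduct.ext (MultilinearMap.ext fun v => ?_)
      have hv : v = fun i => α (v i) • α.symm 1 := by
        funext i
        rw [← map_smul, smul_eq_mul, mul_one, LinearEquiv.symm_apply_apply]
      simp only [LinearMap.compMultilinearMap_apply, LinearMap.id_apply,
        LinearMap.smulRight_apply, tensorEval_tprod]
      conv_lhs => rw [hv]
      rw [MultilinearMap.map_smul_univ]
      rfl
    exact LinearMap.congr_fun this u
  intro u v huv
  rw [key u, key v, huv]

end tensor

variable {L : M → Type*} [∀ x, AddCommGroup (L x)] [∀ x, Module ℂ (L x)]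
  [∀ x, TopologicalSpace (L x)] [TopologicalSpace (TotalSpace ℂ L)] [FiberBundle ℂ L]
  [VectorBundle ℂ ℂ L]

variable (n M L) in
/-- A smooth Hermitian metric on the line bundle `L`, antilinear in the first argument. -/
structure HermitianMetric where
  /-- the Hermitian form on each fibre -/
  toFun : ∀ x, L x →ₗ⋆[ℂ] L x →ₗ[ℂ] ℂ
  conj_symm : ∀ x (u v : L x), conj (toFun x v u) = toFun x u v
  pos : ∀ x (u : L x), u ≠ 0 → 0 < (toFun x u u).re
  smooth : ∀ (t : Trivialization ℂ (π ℂ L)) [MemTrivializationAtlas t],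
    ContMDiffOn 𝓘(ℝ, Cn n) 𝓘(ℝ, ℝ) ∞ (fun x => (toFun x (t.symm x 1) (t.symm x 1)).re) t.baseSet

namespace HermitianMetric

/-- The function `ĥ = h(e, e)` that represents `h` in the local frame `e` given by the local
trivialization `t`. -/
def localRep (h : HermitianMetric n M L) (t : Trivialization ℂ (π ℂ L)) (x : M) : ℝ :=
  (h.toFun x (t.symm x 1) (t.symm x 1)).re

/-- The metric `h^{(m)}` on `L^{⊗m}` computed in the frame `e^{⊗m}`, where `e` is the local frame
given by `t`: it is represented by `ĥ^m`. -/
def powAt (h : HermitianMetric n M L) (m : ℕ) (x : M) (t : Trivialization ℂ (π ℂ L))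
    [MemTrivializationAtlas t] (u v : ⨂[ℂ]^m (L x)) : ℂ :=
  conj (tensorEval (t.linearMapAt ℂ x) m u) * tensorEval (t.linearMapAt ℂ x) m v *
    ((h.localRep t x ^ m : ℝ) : ℂ)

/-- The metric `h^{(m)}` induced by `h` on `L^{⊗m}`, the one with
`h^{(m)}(u₁ ⊗ ⋯ ⊗ uₘ, v₁ ⊗ ⋯ ⊗ vₘ) = ∏ h(uᵢ, vᵢ)` (see `pow_tprod`). -/
def pow (h : HermitianMetric n M L) (m : ℕ) (x : M) (u v : ⨂[ℂ]^m (L x)) : ℂ :=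
  h.powAt m x (trivializationAt ℂ L x) u v

theorem apply_self_eq (h : HermitianMetric n M L) (x : M) (u : L x) :
    h.toFun x u u = ((h.toFun x u u).re : ℂ) :=
  (Complex.conj_eq_iff_re.1 (h.conj_symm x u u)).symm

theorem localRep_pos (h : HermitianMetric n M L) (t : Trivialization ℂ (π ℂ L))
    [MemTrivializationAtlas t] {x : M} (hx : x ∈ t.baseSet) : 0 < h.localRep t x := by
  refine h.pos x _ fun h0 => ?_
  have := t.linearMapAt_symm (R := ℂ) hx 1
  rw [h0, map_zero] at this
  exact zero_ne_one this

/-- `powAt` does not depend on the local frame. -/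
theorem powAt_eq (h : HermitianMetric n M L) (m : ℕ) {x : M}
    (t t' : Trivialization ℂ (π ℂ L)) [MemTrivializationAtlas t] [MemTrivializationAtlas t']
    (hx : x ∈ t.baseSet) (hx' : x ∈ t'.baseSet) (u v : ⨂[ℂ]^m (L x)) :
    h.powAt m x t u v = h.powAt m x t' u v := by
  set c : ℂ := t'.linearMapAt ℂ x (t.symm x 1) with hc
  have e1 : t'.linearMapAt ℂ x = c • t.linearMapAt ℂ x := by
    ext w
    have hw : w = (t.linearMapAt ℂ x w) • t.symm x 1 := by
      conv_lhs => rw [← t.symmₗ_linearMapAt (R := ℂ) hx w]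
      rw [← t.symmₗ_apply (R := ℂ) hx, ← map_smul, smul_eq_mul, mul_one]
    conv_lhs => rw [hw]
    rw [map_smul, ← hc, LinearMap.smul_apply, smul_eq_mul, smul_eq_mul, mul_comm]
  have e2 : t.symm x 1 = c • t'.symm x 1 := by
    have := t'.symmₗ_linearMapAt (R := ℂ) hx' (t.symm x 1)
    rw [← hc] at this
    rw [← this, ← t'.symmₗ_apply (R := ℂ) hx', ← map_smul, smul_eq_mul, mul_one]
  have e3 : h.localRep t x = Complex.normSq c * h.localRep t' x := by
    rw [localRep, localRep, e2]
    simp only [LinearMap.map_smulₛₗ, LinearMap.smul_apply, smul_eq_mul, RingHom.id_apply]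
    rw [apply_self_eq h x (t'.symm x 1), ← mul_assoc, Complex.mul_conj,
      ← Complex.ofReal_mul, Complex.ofReal_re, Complex.ofReal_re]
  rw [powAt, powAt, e1, e3, tensorEval_smul]
  simp only [LinearMap.smul_apply, smul_eq_mul, map_mul, map_pow, Complex.ofReal_pow,
    Complex.ofReal_mul, Complex.normSq_eq_conj_mul_self]
  ring

theorem pow_eq (h : HermitianMetric n M L) (m : ℕ) {x : M}
    (t : Trivialization ℂ (π ℂ L)) [MemTrivializationAtlas t]
    (hx : x ∈ t.baseSet) (u v : ⨂[ℂ]^m (L x)) : h.pow m x u v = h.powAt m x t u v :=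
  h.powAt_eq m _ _ (mem_baseSet_trivializationAt ℂ L x) hx u v

/-- `h^{(m)}(u₁ ⊗ ⋯ ⊗ uₘ, v₁ ⊗ ⋯ ⊗ vₘ) = ∏ h(uᵢ, vᵢ)`. -/
theorem pow_tprod (h : HermitianMetric n M L) (m : ℕ) (x : M) (u v : Fin m → L x) :
    h.pow m x (PiTensorProduct.tprod ℂ u) (PiTensorProduct.tprod ℂ v) =
      ∏ i, h.toFun x (u i) (v i) := by
  set t := trivializationAt ℂ L x
  have hx : x ∈ t.baseSet := mem_baseSet_trivializationAt ℂ L x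
  have hw : ∀ w : L x, w = (t.linearMapAt ℂ x w) • t.symm x 1 := by
    intro w
    conv_lhs => rw [← t.symmₗ_linearMapAt (R := ℂ) hx w]
    rw [← t.symmₗ_apply (R := ℂ) hx, ← map_smul, smul_eq_mul, mul_one]
  have h1 : ∀ i, h.toFun x (u i) (v i) = conj (t.linearMapAt ℂ x (u i)) *
      t.linearMapAt ℂ x (v i) * ((h.localRep t x : ℝ) : ℂ) := by
    intro i
    conv_lhs => rw [hw (u i), hw (v i)]
    simp only [LinearMap.map_smulₛₗ, LinearMap.smul_apply, smul_eq_mul, RingHom.id_apply]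
    rw [apply_self_eq h x (t.symm x 1), localRep]
    ring
  rw [Finset.prod_congr rfl fun i _ => h1 i, Finset.prod_mul_distrib, Finset.prod_mul_distrib]
  simp [pow, powAt, tensorEval_tprod, t]

theorem pow_self (h : HermitianMetric n M L) (m : ℕ) (x : M) (u : ⨂[ℂ]^m (L x)) :
    h.pow m x u u =
      ((Complex.normSq (tensorEval ((trivializationAt ℂ L x).linearMapAt ℂ x) m u) *
        h.localRep (trivializationAt ℂ L x) x ^ m : ℝ) : ℂ) := by
  rw [pow, powAt, Complex.ofReal_mul, Complex.normSq_eq_conj_mul_self]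

theorem pow_self_nonneg (h : HermitianMetric n M L) (m : ℕ) (x : M) (u : ⨂[ℂ]^m (L x)) :
    0 ≤ (h.pow m x u u).re := by
  rw [pow_self, Complex.ofReal_re]
  exact mul_nonneg (Complex.normSq_nonneg _)
    (pow_nonneg (h.localRep_pos _ (mem_baseSet_trivializationAt ℂ L x)).le _)

theorem eq_zero_of_pow_self (h : HermitianMetric n M L) (m : ℕ) (x : M) {u : ⨂[ℂ]^m (L x)}
    (hu : (h.pow m x u u).re = 0) : u = 0 := by
  have hx := mem_baseSet_trivializationAt ℂ L x
  rw [pow_self, Complex.ofReal_re] at hu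
  have h1 := (mul_eq_zero.1 hu).resolve_right
    (pow_ne_zero _ (h.localRep_pos (trivializationAt ℂ L x) hx).ne')
  rw [Complex.normSq_eq_zero] at h1
  have h2 : (trivializationAt ℂ L x).linearMapAt ℂ x =
      (((trivializationAt ℂ L x).linearEquivAt ℂ x hx : L x ≃ₗ[ℂ] ℂ) : L x →ₗ[ℂ] ℂ) :=
    Trivialization.linearMapAt_def_of_mem _ hx
  rw [h2] at h1
  exact tensorEval_injective m _ (h1.trans (map_zero _).symm)

end HermitianMetric

variable (n L) in
/-- The space of global (real) `C^∞` sections of `L^{⊗m}`: in every local frame `e^{⊗m}`, where `e`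
is a local holomorphic frame of `L`, the coefficient function is smooth. -/
def smoothSections (m : ℕ) : Submodule ℂ (∀ x, ⨂[ℂ]^m (L x)) where
  carrier := {s | ∀ (t : Trivialization ℂ (π ℂ L)) [MemTrivializationAtlas t],
    ContMDiffOn 𝓘(ℝ, Cn n) 𝓘(ℝ, ℂ) ∞
      (fun x => tensorEval (t.linearMapAt ℂ x) m (s x)) t.baseSet}
  add_mem' := by
    intro a b ha hb t _
    exact ((ha t).add (hb t)).congr fun x _ => map_add _ _ _
  zero_mem' := by
    intro t _
    exact contMDiffOn_const.congr fun x _ => map_zero _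
  smul_mem' := by
    intro c a ha t _
    exact ((contDiff_const (c := c)).mul contDiff_id).contMDiff.comp_contMDiffOn (ha t) |>.congr
      fun x _ =>
      (tensorEval (t.linearMapAt ℂ x) m).map_smul c (a x)

theorem HermitianMetric.continuous_pow (h : HermitianMetric n M L) {m : ℕ}
    {s s' : ∀ x, ⨂[ℂ]^m (L x)} (hs : s ∈ smoothSections n L m) (hs' : s' ∈ smoothSections n L m) :
    Continuous fun x => h.pow m x (s x) (s' x) := by
  refine continuous_iff_continuousAt.2 fun x₀ => ?_
  set t := trivializationAt ℂ L x₀ with ht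
  have hx₀ : t.baseSet ∈ 𝓝 x₀ :=
    t.open_baseSet.mem_nhds (mem_baseSet_trivializationAt ℂ L x₀)
  have hc : ContinuousOn (fun x => h.powAt m x t (s x) (s' x)) t.baseSet :=
    ((Complex.continuous_conj.comp_continuousOn (hs t).continuousOn).mul
      (hs' t).continuousOn).mul
      (Complex.continuous_ofReal.comp_continuousOn ((h.smooth t).continuousOn.pow m))
  refine (hc.continuousAt hx₀).congr ?_
  filter_upwards [hx₀] with x hx
  exact (h.pow_eq m t hx _ _).symm

/-! ### Quantum line bundles -/

/-- The Wirtinger derivative `∂F/∂z_j = (∂F/∂x_j - i ∂F/∂y_j) / 2`. -/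
def wirtinger (j : Fin n) (F : Cn n → ℂ) (z : Cn n) : ℂ :=
  (fderiv ℝ F z (Pi.single j 1) - Complex.I * fderiv ℝ F z (Pi.single j Complex.I)) / 2

/-- The Wirtinger derivative `∂F/∂z̄_j = (∂F/∂x_j + i ∂F/∂y_j) / 2`. -/
def wirtingerBar (j : Fin n) (F : Cn n → ℂ) (z : Cn n) : ℂ :=
  (fderiv ℝ F z (Pi.single j 1) + Complex.I * fderiv ℝ F z (Pi.single j Complex.I)) / 2

variable (L) in
/-- The structure of a quantum line bundle on the holomorphic line bundle `L` over the Kähler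
manifold `(M, κ)`: a Hermitian metric `h` such that `i ∂̄∂ log ĥ = κ`. This is the prequantum
condition `curv = -i κ` for the unique connection compatible with the metric and the complex
structure. In coordinates, `i ∂̄∂φ = -i ∑ (∂²φ/∂z̄_k∂z_j) dz_j ∧ dz̄_k`. -/
structure QuantumLineBundle (κ : KaehlerForm n M) where
  /-- the Hermitian metric `h` -/
  metric : HermitianMetric n M L
  quantum : ∀ e ∈ atlas (Cn n) M, ∀ (t : Trivialization ℂ (π ℂ L)) [MemTrivializationAtlas t],
    ∀ z ∈ e.target, e.symm z ∈ t.baseSet → ∀ j k : Fin n,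
      κ.coeff e z j k = - wirtingerBar k
        (wirtinger j fun w => ((Real.log (metric.localRep t (e.symm w)) : ℝ) : ℂ)) z

variable (n L) in
/-- `L` is very ample: its global holomorphic sections define an embedding
`x ↦ (ŝ_0(x) : ⋯ : ŝ_N(x))` of the compact manifold `M` into projective space. That is, they have
no common zero (the map is defined), they separate points (it is injective) and they separate
tangent vectors (it is an immersion). -/
structure VeryAmple : Prop where
  basePointFree : ∀ x : M, ∃ s : Cₛ^ω⟮𝓘(ℂ, Cn n); ℂ, L⟯, s x ≠ 0
  separatesPoints : ∀ x y : M, x ≠ y →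
    ∃ s : Cₛ^ω⟮𝓘(ℂ, Cn n); ℂ, L⟯, s x = 0 ∧ s y ≠ 0
  separatesTangents : ∀ (x : M) (v : TangentSpace 𝓘(ℂ, Cn n) x), v ≠ 0 →
    ∃ s : Cₛ^ω⟮𝓘(ℂ, Cn n); ℂ, L⟯, s x = 0 ∧
      mfderiv 𝓘(ℂ, Cn n) 𝓘(ℂ, ℂ)
        (fun y => (trivializationAt ℂ L x).linearMapAt ℂ y (s y)) x v ≠ 0

namespace QuantumLineBundle

variable {κ : KaehlerForm n M}

/-- The space `Γ_∞(M, L^m)` of global smooth sections of `L^m`, as a space of its own, to carry the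
scalar product given by the metric of `Q` and the Liouville measure. -/
def SmoothSection (_Q : QuantumLineBundle L κ) (m : ℕ) : Type _ := smoothSections n L m

@[reducible] def smoothSectionAddCommGroup (Q : QuantumLineBundle L κ) (m : ℕ) :
    AddCommGroup (Q.SmoothSection m) :=
  inferInstanceAs (AddCommGroup (smoothSections n L m))

@[reducible] def smoothSectionModule (Q : QuantumLineBundle L κ) (m : ℕ) :
    letI := Q.smoothSectionAddCommGroup m
    Module ℂ (Q.SmoothSection m) :=
  inferInstanceAs (Module ℂ (smoothSections n L m))

/-- The value of a section at a point. -/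
def SmoothSection.val {Q : QuantumLineBundle L κ} {m : ℕ} (s : Q.SmoothSection m) :
    ∀ x, ⨂[ℂ]^m (L x) := Subtype.val (show smoothSections n L m from s)

instance (Q : QuantumLineBundle L κ) (m : ℕ) :
    CoeFun (Q.SmoothSection m) fun _ => ∀ x, ⨂[ℂ]^m (L x) := ⟨SmoothSection.val⟩

variable [CompactSpace M] [T2Space M] [MeasurableSpace M] [BorelSpace M]

theorem integrable_pow (Q : QuantumLineBundle L κ) {m : ℕ} (s s' : Q.SmoothSection m) :
    Integrable (fun x => Q.metric.pow m x (s x) (s' x)) κ.liouville :=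
  (Q.metric.continuous_pow s.2 s'.2).integrable_of_hasCompactSupport
    (HasCompactSupport.of_compactSpace _)

/-- The scalar product `⟨s, s'⟩ = ∫ h^{(m)}(s, s') Ω`. -/
def scalarProduct (Q : QuantumLineBundle L κ) {m : ℕ} (s s' : Q.SmoothSection m) : ℂ :=
  ∫ x, Q.metric.pow m x (s x) (s' x) ∂κ.liouville

theorem scalarProduct_self (Q : QuantumLineBundle L κ) {m : ℕ} (s : Q.SmoothSection m) :
    Q.scalarProduct s s =
      ((∫ x, (Q.metric.pow m x (s x) (s x)).re ∂κ.liouville : ℝ) : ℂ) := by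
  refine Eq.trans ?_ integral_ofReal
  exact integral_congr_ae (Filter.Eventually.of_forall fun x => by
    change Q.metric.pow m x (s x) (s x) = ((Q.metric.pow m x (s x) (s x)).re : ℂ)
    rw [Q.metric.pow_self, Complex.ofReal_re])

variable [IsManifold 𝓘(ℂ, Cn n) ω M]

section
attribute [local instance] smoothSectionAddCommGroup smoothSectionModule

@[reducible] def innerCore (Q : QuantumLineBundle L κ) (m : ℕ) :
    InnerProductSpace.Core ℂ (Q.SmoothSection m) where
  inner := Q.scalarProduct
  conj_inner_symm s s' := by
    simp only [scalarProduct]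
    rw [← integral_conj]
    refine integral_congr_ae (Filter.Eventually.of_forall fun x => ?_)
    simp only [HermitianMetric.pow, HermitianMetric.powAt, map_mul, Complex.conj_conj,
      Complex.conj_ofReal]
    ring
  re_inner_nonneg s := by
    change 0 ≤ (Q.scalarProduct s s).re
    rw [Q.scalarProduct_self, Complex.ofReal_re]
    exact integral_nonneg fun x => Q.metric.pow_self_nonneg m x _
  add_left s s' s'' := by
    simp only [scalarProduct]
    rw [← integral_add (Q.integrable_pow _ _) (Q.integrable_pow _ _)]
    refine integral_congr_ae (Filter.Eventually.of_forall fun x => ?_)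
    have : (s + s') x = s x + s' x := rfl
    simp only [this, HermitianMetric.pow, HermitianMetric.powAt, map_add]
    ring
  smul_left s s' c := by
    simp only [scalarProduct]
    rw [← integral_const_mul]
    refine integral_congr_ae (Filter.Eventually.of_forall fun x => ?_)
    have : (c • s) x = c • s x := rfl
    simp only [this, HermitianMetric.pow, HermitianMetric.powAt, map_smul, smul_eq_mul, map_mul]
    ring
  definite s hs := by
    change Q.scalarProduct s s = 0 at hs
    rw [Q.scalarProduct_self, Complex.ofReal_eq_zero] at hs
    refine Subtype.ext (funext fun x => ?_)
    by_contra hx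
    refine (Continuous.integral_pos_of_hasCompactSupport_nonneg_nonzero (μ := κ.liouville)
      (f := fun x => (Q.metric.pow m x (s x) (s x)).re) (x := x)
      (Complex.continuous_re.comp (Q.metric.continuous_pow s.2 s.2))
      (HasCompactSupport.of_compactSpace _)
      (fun x => Q.metric.pow_self_nonneg m x _) fun h0 => hx ?_).ne' hs
    exact Q.metric.eq_zero_of_pow_self m x h0

instance (Q : QuantumLineBundle L κ) (m : ℕ) : NormedAddCommGroup (Q.SmoothSection m) :=
  (Q.innerCore m).toNormedAddCommGroup

instance (Q : QuantumLineBundle L κ) (m : ℕ) : InnerProductSpace ℂ (Q.SmoothSection m) :=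
  InnerProductSpace.ofCore (Q.innerCore m).toCore

end

theorem inner_eq (Q : QuantumLineBundle L κ) {m : ℕ} (s s' : Q.SmoothSection m) :
    inner ℂ s s' = ∫ x, Q.metric.pow m x (s x) (s' x) ∂κ.liouville := rfl

/-- The space `Γ_hol(M, L^m)` of global holomorphic sections, as a subspace of `Γ_∞(M, L^m)`. -/
def holSections (Q : QuantumLineBundle L κ) (m : ℕ) : Submodule ℂ (Q.SmoothSection m) where
  carrier := {s | ∀ (t : Trivialization ℂ (π ℂ L)) [MemTrivializationAtlas t],
    MDifferentiableOn 𝓘(ℂ, Cn n) 𝓘(ℂ, ℂ)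
      (fun x => tensorEval (t.linearMapAt ℂ x) m (s x)) t.baseSet}
  add_mem' := by
    intro a b ha hb t _ x hx
    exact ((ha t x hx).add (hb t x hx)).congr (fun x _ => map_add _ _ _) (map_add _ _ _)
  zero_mem' := by
    intro t _
    exact mdifferentiableOn_const.congr fun x _ => map_zero _
  smul_mem' := by
    intro c a ha t _ x hx
    exact ((ha t x hx).const_smul c).congr
      (fun x _ => (tensorEval (t.linearMapAt ℂ x) m).map_smul c (a x))
      ((tensorEval (t.linearMapAt ℂ x) m).map_smul c (a x))

/-- Multiplication of sections by the complex valued smooth function `f`. -/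
def mulSmooth (Q : QuantumLineBundle L κ) (m : ℕ) (f : C^∞⟮𝓘(ℝ, Cn n), M; 𝓘(ℝ, ℂ), ℂ⟯) :
    Q.SmoothSection m →ₗ[ℂ] Q.SmoothSection m where
  toFun s := ⟨fun x => f x • s x, by
    intro t _
    exact (contDiff_fst.mul contDiff_snd).contMDiff.comp_contMDiffOn
      (f.contMDiff.contMDiffOn.prodMk_space (s.2 t)) |>.congr fun x _ =>
      (tensorEval (t.linearMapAt ℂ x) m).map_smul (f x) (s x)⟩
  map_add' s s' := Subtype.ext (funext fun x => smul_add (f x) (s x) (s' x))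
  map_smul' c s := Subtype.ext (funext fun x => smul_comm (f x) c (s x))

section operators
variable (Q : QuantumLineBundle L κ) (m : ℕ) [FiniteDimensional ℂ (Q.holSections m)]

/-- The Toeplitz operator `T_f^{(m)} = Π^{(m)} (f ·)` on `Γ_hol(M, L^m)`, where `Π^{(m)}` is the
orthogonal projection onto the holomorphic sections. -/
def toeplitz (f : C^∞⟮𝓘(ℝ, Cn n), M; 𝓘(ℝ, ℂ), ℂ⟯) : Module.End ℂ (Q.holSections m) :=
  (Q.holSections m).orthogonalProjectionOnto.toLinearMap ∘ₗ Q.mulSmooth m f ∘ₗ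
    (Q.holSections m).subtype

variable {m} in
/-- The linear form `s ↦ α^{⊗m}(s(x))` on `Γ_hol(M, L^m)` given by `α` in the dual of `L x`. -/
def evalForm (x : M) (α : Module.Dual ℂ (L x)) : Module.Dual ℂ (Q.holSections m) where
  toFun s := tensorEval α m (s.1 x)
  map_add' s s' := map_add (tensorEval α m) (s.1 x) (s'.1 x)
  map_smul' c s := map_smul (tensorEval α m) c (s.1 x)

/-- The coherent vector `e_α^{(m)}`: the element of `Γ_hol(M, L^m)` with
`⟨e_α^{(m)}, s⟩ = α^{⊗m}(s(x))` for all `s` (see `inner_coherentVector`). -/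
def coherentVector (x : M) (α : Module.Dual ℂ (L x)) : Q.holSections m :=
  have : CompleteSpace (Q.holSections m) := FiniteDimensional.complete ℂ _
  (InnerProductSpace.toDual ℂ (Q.holSections m)).symm
    (LinearMap.toContinuousLinearMap (Q.evalForm x α))

theorem inner_coherentVector (x : M) (α : Module.Dual ℂ (L x)) (s : Q.holSections m) :
    inner ℂ (Q.coherentVector m x α) s = tensorEval α m (s.1 x) := by
  have : CompleteSpace (Q.holSections m) := FiniteDimensional.complete ℂ _
  rw [coherentVector, InnerProductSpace.toDual_symm_apply]
  rfl

theorem coherentVector_smul (x : M) (c : ℂ) (α : Module.Dual ℂ (L x)) :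
    Q.coherentVector m x (c • α) = (conj c) ^ m • Q.coherentVector m x α := by
  refine ext_inner_right ℂ fun s => ?_
  rw [inner_smul_left, inner_coherentVector, inner_coherentVector, tensorEval_smul]
  simp

/-- A nonzero element `α` of the fibre over `x` of the dual bundle of `L`. The coherent projector and
the epsilon function do not depend on its choice, by `coherentVector_smul`. -/
def fibreForm (x : M) : Module.Dual ℂ (L x) := (trivializationAt ℂ L x).linearMapAt ℂ x

/-- The coherent projector `P_x^{(m)} = |e_α⟩⟨e_α| / ⟨e_α, e_α⟩`. -/
def coherentProjector (x : M) : Q.holSections m →L[ℂ] Q.holSections m :=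
  (inner ℂ (Q.coherentVector m x (fibreForm x)) (Q.coherentVector m x (fibreForm x)))⁻¹ •
    InnerProductSpace.rankOne ℂ (Q.coherentVector m x (fibreForm x))
      (Q.coherentVector m x (fibreForm x))

/-- Rawnsley's function `ε^{(m)}(x) = h^{(m)}(e_α, e_α)(x) / ⟨e_α, e_α⟩`. -/
def epsilon (x : M) : ℝ :=
  (Q.metric.pow m x ((Q.coherentVector m x (fibreForm x)).1 x)
      ((Q.coherentVector m x (fibreForm x)).1 x)).re /
    (inner ℂ (Q.coherentVector m x (fibreForm x)) (Q.coherentVector m x (fibreForm x))).re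

/-- The modified Liouville measure `Ω_ε^{(m)} = ε^{(m)} Ω`. -/
def modifiedMeasure : Measure M :=
  κ.liouville.withDensity fun x => ENNReal.ofReal (Q.epsilon m x)

instance instNormedAddCommGroupOperators :
    NormedAddCommGroup (Q.holSections m →L[ℂ] Q.holSections m) :=
  ContinuousLinearMap.toNormedAddCommGroup

instance instNormedSpaceOperators :
    NormedSpace ℂ (Q.holSections m →L[ℂ] Q.holSections m) :=
  ContinuousLinearMap.toNormedSpace

/-- The smooth function `f` is a contravariant Berezin symbol of the operator `A` on
`Γ_hol(M, L^m)`: `A = ∫ f(x) P_x^{(m)} Ω_ε^{(m)}(x)`, an integral (required to converge) in the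
finite-dimensional space of operators. -/
def IsContravariantSymbol (A : Module.End ℂ (Q.holSections m))
    (f : C^∞⟮𝓘(ℝ, Cn n), M; 𝓘(ℝ, ℂ), ℂ⟯) : Prop :=
  Integrable (fun x => f x • Q.coherentProjector m x) (Q.modifiedMeasure m) ∧
    LinearMap.toContinuousLinearMap A =
      ∫ x, f x • Q.coherentProjector m x ∂(Q.modifiedMeasure m)

end operators

end QuantumLineBundle

end BerezinToeplitz

end

open BerezinToeplitz

/-! Everything rests on the pointwise identity `ε(x) ⟨s, P_x t⟩ = h^{(m)}(s, t)(x)` for holomorphic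
`s`, `t` (`epsilon_mul_inner_coherentProjector`). By it, the matrix elements of `∫ f P_x Ω_ε` are `∫
f h^{(m)}(s, t) Ω = ⟨s, f t⟩`. This equals `⟨s, T_f t⟩`, since `s` is holomorphic and the projection
can be dropped. Hence `f` is a contravariant symbol of `T_f`, and the second claim reduces to
surjectivity of `f ↦ T_f`.

Surjectivity is a duality argument. A linear functional `φ` on operators has the form `A ↦ ∑ a_ij
⟨b_i, A b_j⟩` for an orthonormal basis `b`, so `φ(T_f) = ∫ f u Ω` with `u = ∑ a_ij h^{(m)}(b_i,
b_j)`. If `φ` kills every `T_f`, testing with `f = conj u` gives `u = 0`. It remains to see that the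
functions `h^{(m)}(b_i, b_j)` are linearly independent (`eq_zero_of_sum_mul_pow_eq_zero`). In a
local frame the relation reads `∑ a_ij conj(g_i(z)) g_j(z) = 0` with holomorphic `g_i`. Polarization
(`sum_conj_center_mul_eq_zero`) decouples the two occurrences of `z`, the identity theorem
globalizes the result on the connected manifold, and independence of the `b_i`, used once for each
index, gives `a = 0`.

Finite-dimensionality comes from the Schwarz lemma and compactness: a section vanishing at `p` has
at most half its maximal squared norm near `p`. So a section vanishing at finitely many suitable
points is zero. -/

namespace BerezinToeplitz

/-! ### Polarization and the identity theorem on balls -/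

section analysis

/-- If `∑ conj gᵢ fᵢ` vanishes on an open set of `ℂ`, with `fᵢ`, `gᵢ` holomorphic, then so does
`∑ conj gᵢ fᵢ'`. -/
theorem sum_conj_mul_deriv_eq_zero {ι : Type*} [Fintype ι] {f g : ι → ℂ → ℂ} {U : Set ℂ}
    (hU : IsOpen U) (hf : ∀ i, DifferentiableOn ℂ (f i) U) (hg : ∀ i, DifferentiableOn ℂ (g i) U)
    (h : ∀ z ∈ U, ∑ i, conj (g i z) * f i z = 0) {z : ℂ} (hz : z ∈ U) :
    ∑ i, conj (g i z) * deriv (f i) z = 0 := by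
  -- Since `conj ∘ g i` is only real differentiable, the relation is differentiated along the real
  -- line `t ↦ z + t v`.
  have key : ∀ v : ℂ, ∑ i, (conj (v * deriv (g i) z) * f i z +
      conj (g i z) * (v * deriv (f i) z)) = 0 := by
    intro v
    have hl : HasDerivAt (fun t : ℝ => z + (t : ℂ) * v) v 0 := by
      simpa using ((Complex.ofRealCLM.hasDerivAt (x := (0 : ℝ))).mul_const v).const_add z
    have hl0 : z + ((0 : ℝ) : ℂ) * v = z := by simp
    have hcomp : ∀ F : ℂ → ℂ, DifferentiableOn ℂ F U →
        HasDerivAt (fun t : ℝ => F (z + (t : ℂ) * v)) (v * deriv F z) 0 := by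
      intro F hF
      have hF' : HasDerivAt F (deriv F z) (z + ((0 : ℝ) : ℂ) * v) := by
        rw [hl0]; exact (hF.differentiableAt (hU.mem_nhds hz)).hasDerivAt
      simpa [smul_eq_mul] using! hF'.scomp (0 : ℝ) hl
    have hd := HasDerivAt.fun_sum (u := Finset.univ) fun i _ =>
      ((hcomp (g i) (hg i)).star).mul (hcomp (f i) (hf i))
    have h0 : (fun t : ℝ => ∑ i, conj (g i (z + (t : ℂ) * v)) * f i (z + (t : ℂ) * v))
        =ᶠ[𝓝 0] fun _ => 0 := by
      have hc : Filter.Tendsto (fun t : ℝ => z + (t : ℂ) * v) (𝓝 0) (𝓝 z) := by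
        simpa using hl.continuousAt.tendsto
      filter_upwards [hc (hU.mem_nhds hz)] with t ht using h _ ht
    have := hd.unique ((hasDerivAt_const (0 : ℝ) (0 : ℂ)).congr_of_eventuallyEq h0)
    simpa [hl0] using! this
  have h1 := key 1
  have hI := key Complex.I
  simp only [Finset.sum_add_distrib, map_mul, one_mul, Complex.conj_I] at h1 hI
  have e1 : ∑ i, -Complex.I * conj (deriv (g i) z) * f i z =
      -Complex.I * ∑ i, conj (deriv (g i) z) * f i z := by
    rw [Finset.mul_sum]; exact Finset.sum_congr rfl fun i _ => by ring
  have e2 : ∑ i, conj (g i z) * (Complex.I * deriv (f i) z) =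
      Complex.I * ∑ i, conj (g i z) * deriv (f i) z := by
    rw [Finset.mul_sum]; exact Finset.sum_congr rfl fun i _ => by ring
  rw [e1, e2] at hI
  -- With `S = ∑ conj(gᵢ') fᵢ` and `T = ∑ conj(gᵢ) fᵢ'`, the direction `v` gives `conj v * S + v * T
  -- = 0`. The directions `1` and `I` together isolate `T`, as a Wirtinger derivative does.
  linear_combination (1 / 2 : ℂ) * h1 - (1 / 2) * Complex.I * hI -
    (1 / 2) * (∑ i, conj (deriv (g i) z) * f i z - ∑ i, conj (g i z) * deriv (f i) z) *
      Complex.I_sq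

/-- The antiholomorphic factors are constant for `∂/∂z`, so the first-order statement can be applied
again with `fᵢ'` in place of `fᵢ` and the same `gᵢ`. -/
theorem sum_conj_mul_iteratedDeriv_eq_zero {ι : Type*} [Fintype ι] {f g : ι → ℂ → ℂ} {U : Set ℂ}
    (hU : IsOpen U) (hf : ∀ i, DifferentiableOn ℂ (f i) U) (hg : ∀ i, DifferentiableOn ℂ (g i) U)
    (h : ∀ z ∈ U, ∑ i, conj (g i z) * f i z = 0) (k : ℕ) :
    ∀ z ∈ U, ∑ i, conj (g i z) * iteratedDeriv k (f i) z = 0 := by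
  induction k generalizing f with
  | zero => simpa using h
  | succ k ih =>
    simp only [iteratedDeriv_succ']
    exact ih (fun i => (hf i).deriv hU) fun z hz => sum_conj_mul_deriv_eq_zero hU hf hg h hz

variable {E : Type*} [NormedAddCommGroup E] [NormedSpace ℂ E]

/-- Polarization: if `∑ conj (gᵢ z) fᵢ z = 0` on a ball, with `fᵢ`, `gᵢ` holomorphic, then
`∑ conj (gᵢ c) fᵢ z = 0` on that ball, where `c` is the centre. -/
theorem sum_conj_center_mul_eq_zero {ι : Type*} [Fintype ι] {f g : ι → E → ℂ} {c : E} {r : ℝ}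
    (hf : ∀ i, DifferentiableOn ℂ (f i) (Metric.ball c r))
    (hg : ∀ i, DifferentiableOn ℂ (g i) (Metric.ball c r))
    (h : ∀ z ∈ Metric.ball c r, ∑ i, conj (g i z) * f i z = 0) {z : E}
    (hz : z ∈ Metric.ball c r) : ∑ i, conj (g i c) * f i z = 0 := by
  have hr : 0 < r := Metric.nonempty_ball.1 ⟨z, hz⟩
  rcases eq_or_ne z c with rfl | hne
  · exact h z hz
  have hpos : 0 < ‖z - c‖ := norm_pos_iff.2 (sub_ne_zero.2 hne)
  -- Restriction to the complex line `w ↦ c + w • (z - c)` reduces to one variable: `w = 0` is the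
  -- centre, `w = 1` is `z`, and the disc of radius `R > 1` is mapped into the ball.
  set R := r / ‖z - c‖ with hR
  have hmaps : Set.MapsTo (fun w : ℂ => c + w • (z - c)) (Metric.ball 0 R) (Metric.ball c r) := by
    intro w hw
    rw [mem_ball_zero_iff, hR, lt_div_iff₀ hpos] at hw
    simpa [Metric.mem_ball, dist_eq_norm, norm_smul] using hw
  have hline : Differentiable ℂ fun w : ℂ => c + w • (z - c) := by fun_prop
  have hF : ∀ i, DifferentiableOn ℂ (fun w : ℂ => f i (c + w • (z - c))) (Metric.ball 0 R) :=
    fun i => (hf i).comp hline.differentiableOn hmaps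
  have hG : ∀ i, DifferentiableOn ℂ (fun w : ℂ => g i (c + w • (z - c))) (Metric.ball 0 R) :=
    fun i => (hg i).comp hline.differentiableOn hmaps
  have hit := sum_conj_mul_iteratedDeriv_eq_zero Metric.isOpen_ball hF hG
    fun w hw => h _ (hmaps hw)
  have hR1 : (1 : ℂ) ∈ Metric.ball (0 : ℂ) R := by
    rw [mem_ball_zero_iff, norm_one, hR, one_lt_div hpos]
    simpa [dist_eq_norm] using Metric.mem_ball.1 hz
  -- At `w = 0` the iterated relation says that every Taylor coefficient of `w ↦ ∑ conj(gᵢ(c)) fᵢ`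
  -- vanishes. The Taylor series is then summed at `w = 1`.
  have hs := hasSum_sum (s := Finset.univ) fun i (_ : i ∈ Finset.univ) =>
    (Complex.hasSum_taylorSeries_on_ball (hF i) hR1).mul_left (conj (g i c))
  have hz0 : ∀ k : ℕ, ∑ i, conj (g i c) * ((k.factorial : ℂ)⁻¹ • (1 - 0 : ℂ) ^ k •
      iteratedDeriv k (fun w : ℂ => f i (c + w • (z - c))) 0) = 0 := by
    intro k
    have := hit k 0 (Metric.mem_ball_self (div_pos hr hpos))
    simp only [zero_smul, add_zero] at this
    refine Eq.trans ?_ ((congrArg ((k.factorial : ℂ)⁻¹ * ·) this).trans (mul_zero _))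
    rw [Finset.mul_sum]
    refine Finset.sum_congr rfl fun i _ => ?_
    simp only [sub_zero, one_pow, smul_eq_mul]
    ring
  simp only [hz0, one_smul, add_sub_cancel] at hs
  exact hs.unique hasSum_zero

/-- A holomorphic function on a ball that vanishes near one of its points vanishes. -/
theorem eqOn_zero_ball_of_eventuallyEq_zero {f : E → ℂ} {c : E} {r : ℝ}
    (hf : DifferentiableOn ℂ f (Metric.ball c r)) {y : E} (hy : y ∈ Metric.ball c r)
    (h0 : f =ᶠ[𝓝 y] 0) {z : E} (hz : z ∈ Metric.ball c r) : f z = 0 := by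
  -- On the complex line through `y` and `z` the preimage of the ball is convex, hence connected, so
  -- the one-variable identity theorem carries the vanishing from `w = 0` to `w = 1`.
  set l : ℂ → E := fun w => y + w • (z - y) with hl
  have hline : Differentiable ℂ l := by fun_prop
  have hconv : Convex ℝ (l ⁻¹' Metric.ball c r) := by
    intro a ha b hb s t hs ht hst
    have : l (s • a + t • b) = s • l a + t • l b := by
      have hy' : y = s • y + t • y := by rw [← add_smul, hst, one_smul]
      simp only [hl, smul_add, add_smul, smul_assoc]
      nth_rw 1 [hy']
      abel
    change l _ ∈ Metric.ball c r
    rw [this]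
    exact convex_ball c r ha hb hs ht hst
  have hopen : IsOpen (l ⁻¹' Metric.ball c r) := Metric.isOpen_ball.preimage hline.continuous
  have han : AnalyticOnNhd ℂ (f ∘ l) (l ⁻¹' Metric.ball c r) :=
    (hf.comp hline.differentiableOn (Set.mapsTo_preimage _ _)).analyticOnNhd hopen
  have hl0 : Filter.Tendsto l (𝓝 0) (𝓝 y) := by
    simpa [hl] using hline.continuous.tendsto 0
  have := han.eqOn_zero_of_preconnected_of_eventuallyEq_zero hconv.isPreconnected
    (z₀ := 0) (by simpa [hl] using hy) (hl0.eventually h0)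
    (show (1 : ℂ) ∈ l ⁻¹' Metric.ball c r by simpa [hl] using hz)
  simpa [hl] using this

end analysis

/-! ### Sections of `L^m` in local frames and coordinates -/

variable {n : ℕ} {M : Type*} [TopologicalSpace M] [ChartedSpace (Cn n) M]
  {L : M → Type*} [∀ x, AddCommGroup (L x)] [∀ x, Module ℂ (L x)]
  [∀ x, TopologicalSpace (L x)] [TopologicalSpace (TotalSpace ℂ L)] [FiberBundle ℂ L]
  [VectorBundle ℂ ℂ L]

/-- In a local frame, `u ∈ L_x^{⊗m}` vanishes iff its coefficient does. -/
theorem tensorEval_linearMapAt_eq_zero {t : Trivialization ℂ (π ℂ L)} [MemTrivializationAtlas t]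
    {x : M} (hx : x ∈ t.baseSet) {m : ℕ} {u : ⨂[ℂ]^m (L x)} :
    tensorEval (t.linearMapAt ℂ x) m u = 0 ↔ u = 0 := by
  refine ⟨fun h => ?_, fun h => by rw [h, map_zero]⟩
  have h2 : t.linearMapAt ℂ x = ((t.linearEquivAt ℂ x hx : L x ≃ₗ[ℂ] ℂ) : L x →ₗ[ℂ] ℂ) :=
    Trivialization.linearMapAt_def_of_mem _ hx
  rw [h2] at h
  exact tensorEval_injective m _ (h.trans (map_zero _).symm)

variable (n L) in
/-- Around every point there is a coordinate ball over which `L` is trivialized. -/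
theorem exists_coordBall (p : M) : ∃ r > 0, Metric.ball (chartAt (Cn n) p p) r ⊆
    (chartAt (Cn n) p).target ∩
      (chartAt (Cn n) p).symm ⁻¹' (trivializationAt ℂ L p).baseSet := by
  set e := chartAt (Cn n) p
  have ho := e.isOpen_inter_preimage_symm (trivializationAt ℂ L p).open_baseSet
  refine Metric.isOpen_iff.1 ho _ ⟨mem_chart_target (Cn n) p, ?_⟩
  simpa [e] using mem_baseSet_trivializationAt ℂ L p

/-- The metric of `L^m` on a pair of smooth sections is a smooth function. -/
theorem HermitianMetric.contMDiff_pow (h : HermitianMetric n M L) {m : ℕ}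
    {s s' : ∀ x, ⨂[ℂ]^m (L x)} (hs : s ∈ smoothSections n L m) (hs' : s' ∈ smoothSections n L m) :
    ContMDiff 𝓘(ℝ, Cn n) 𝓘(ℝ, ℂ) ∞ fun x => h.pow m x (s x) (s' x) := by
  intro x₀
  set t := trivializationAt ℂ L x₀ with ht
  have hx₀ : t.baseSet ∈ 𝓝 x₀ :=
    t.open_baseSet.mem_nhds (mem_baseSet_trivializationAt ℂ L x₀)
  have hΦ : ContDiff ℝ ∞ fun q : (ℂ × ℂ) × ℝ => conj q.1.1 * q.1.2 * ((q.2 ^ m : ℝ) : ℂ) :=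
    ((Complex.conjCLE.contDiff.comp (contDiff_fst.comp contDiff_fst)).mul
      (contDiff_snd.comp contDiff_fst)).mul (Complex.ofRealCLM.contDiff.comp (contDiff_snd.pow m))
  have hc : ContMDiffOn 𝓘(ℝ, Cn n) 𝓘(ℝ, ℂ) ∞ (fun x => h.powAt m x t (s x) (s' x)) t.baseSet :=
    hΦ.contMDiff.comp_contMDiffOn (((hs t).prodMk_space (hs' t)).prodMk_space (h.smooth t))
  refine (hc.contMDiffAt hx₀).congr_of_eventuallyEq ?_
  filter_upwards [hx₀] with x hx
  exact h.pow_eq m t hx _ _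

namespace QuantumLineBundle

variable {κ : KaehlerForm n M} [CompactSpace M] [T2Space M] [MeasurableSpace M] [BorelSpace M]
  [IsManifold 𝓘(ℂ, Cn n) ω M]

/-- The coefficient at `x` of a section of `L^m` in the preferred local frame at `p`. -/
noncomputable def frameCoeff (Q : QuantumLineBundle L κ) (m : ℕ) (p x : M) : Q.SmoothSection m →ₗ[ℂ] ℂ where
  toFun s := tensorEval ((trivializationAt ℂ L p).linearMapAt ℂ x) m (s x)
  map_add' s s' := map_add (tensorEval _ m) (s.1 x) (s'.1 x)
  map_smul' c s := map_smul (tensorEval _ m) c (s.1 x)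

variable (Q : QuantumLineBundle L κ) {m : ℕ}

theorem frameCoeff_eq_zero {p x : M} (hx : x ∈ (trivializationAt ℂ L p).baseSet)
    {s : Q.SmoothSection m} : Q.frameCoeff m p x s = 0 ↔ s x = 0 :=
  tensorEval_linearMapAt_eq_zero hx

theorem section_ext_zero {s : Q.SmoothSection m} (h : ∀ x, s x = 0) : s = 0 :=
  Subtype.ext (funext h)

/-- `h^{(m)}(s, s')` in the preferred local frame at `p`. -/
theorem pow_eq_frameCoeff {p x : M} (hx : x ∈ (trivializationAt ℂ L p).baseSet)
    (s s' : Q.SmoothSection m) : Q.metric.pow m x (s x) (s' x) =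
      conj (Q.frameCoeff m p x s) * Q.frameCoeff m p x s' *
        ((Q.metric.localRep (trivializationAt ℂ L p) x ^ m : ℝ) : ℂ) :=
  Q.metric.pow_eq m _ hx _ _

/-- The coefficient of a holomorphic section is holomorphic in local coordinates. -/
theorem differentiableOn_frameCoeff {s : Q.SmoothSection m} (hs : s ∈ Q.holSections m) {p : M}
    {U : Set (Cn n)} (hU : U ⊆ (chartAt (Cn n) p).target ∩
      (chartAt (Cn n) p).symm ⁻¹' (trivializationAt ℂ L p).baseSet) :
    DifferentiableOn ℂ (fun z => Q.frameCoeff m p ((chartAt (Cn n) p).symm z) s) U := by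
  have : IsManifold 𝓘(ℂ, Cn n) 1 M := IsManifold.of_le (n := ω) le_top
  rw [← mdifferentiableOn_iff_differentiableOn]
  exact (hs (trivializationAt ℂ L p)).comp
    ((mdifferentiableOn_atlas_symm (I := 𝓘(ℂ, Cn n)) (chart_mem_atlas (Cn n) p)).mono
      fun z hz => (hU hz).1) fun z hz => (hU hz).2

/-! ### Identity theorem and finite-dimensionality for holomorphic sections -/

/-- Identity theorem: a holomorphic section that vanishes near a point vanishes. -/
theorem eq_zero_of_eventually_eq_zero [ConnectedSpace M] {s : Q.SmoothSection m}
    (hs : s ∈ Q.holSections m) {p : M} (hp : ∀ᶠ x in 𝓝 p, s x = 0) : s = 0 := by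
  set Z : Set M := {q | ∀ᶠ x in 𝓝 q, s x = 0} with hZ
  have hopen : IsOpen Z := isOpen_setOfPred_eventually_nhds
  have hclosed : IsClosed Z := by
    -- A coordinate neighbourhood of a limit point `q` contains some `y ∈ Z`, and vanishing near `y`
    -- spreads over the whole coordinate ball, so also to a neighbourhood of `q`.
    refine isClosed_of_closure_subset fun q hq => ?_
    obtain ⟨r, hr, hball⟩ := exists_coordBall n L q
    set e := chartAt (Cn n) q
    set N : Set M := e.source ∩ e ⁻¹' Metric.ball (e q) r with hN
    have hNo : IsOpen N := e.isOpen_inter_preimage Metric.isOpen_ball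
    have hqN : q ∈ N := ⟨mem_chart_source (Cn n) q, Metric.mem_ball_self hr⟩
    obtain ⟨y, hyN, hyZ⟩ := mem_closure_iff.1 hq N hNo hqN
    have hdiff := Q.differentiableOn_frameCoeff hs hball
    have h0 : (fun z => Q.frameCoeff m q (e.symm z) s) =ᶠ[𝓝 (e y)] 0 := by
      have hc : Filter.Tendsto e.symm (𝓝 (e y)) (𝓝 y) := e.tendsto_symm hyN.1
      filter_upwards [hc.eventually hyZ, Metric.isOpen_ball.mem_nhds hyN.2] with z hz hzb
      exact (Q.frameCoeff_eq_zero (hball hzb).2).2 hz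
    filter_upwards [hNo.mem_nhds hqN] with x hx
    have := eqOn_zero_ball_of_eventuallyEq_zero hdiff hyN.2 h0 hx.2
    rw [e.left_inv hx.1] at this
    refine (Q.frameCoeff_eq_zero ?_).1 this
    have := (hball hx.2).2
    rwa [Set.mem_preimage, e.left_inv hx.1] at this
  have huniv : Z = Set.univ := IsClopen.eq_univ ⟨hclosed, hopen⟩ ⟨p, hp⟩
  refine Q.section_ext_zero fun x => ?_
  have hx : x ∈ Z := huniv ▸ Set.mem_univ x
  exact hx.self_of_nhds

/-- Near each point `p`, a holomorphic section vanishing at `p` has at most half its maximal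
squared norm. -/
theorem exists_nhds_pow_self_le (m : ℕ) (p : M) : ∃ N ∈ 𝓝 p, ∀ s ∈ Q.holSections m, s p = 0 →
    ∀ C : ℝ, (∀ x, (Q.metric.pow m x (s x) (s x)).re ≤ C) →
      ∀ x ∈ N, (Q.metric.pow m x (s x) (s x)).re ≤ C / 2 := by
  obtain ⟨r, hr, hball⟩ := exists_coordBall n L p
  set e := chartAt (Cn n) p with he
  set t := trivializationAt ℂ L p with ht
  have htp : p ∈ t.baseSet := mem_baseSet_trivializationAt ℂ L p
  set a : M → ℝ := fun x => Q.metric.localRep t x ^ m with ha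
  have hac : ContinuousAt a p :=
    ((Q.metric.smooth t).continuousOn.pow m).continuousAt (t.open_baseSet.mem_nhds htp)
  have hapos : 0 < a p := pow_pos (Q.metric.localRep_pos t htp) m
  -- The weight `a` is pinched within a factor 2 of `a p`, so that bounds on the squared norm and on
  -- the coefficient can be exchanged near `p`.
  have hev : ∀ᶠ x in 𝓝 p, a p / 2 < a x ∧ a x < 2 * a p :=
    (hac.eventually (lt_mem_nhds (half_lt_self hapos))).and
      (hac.eventually (gt_mem_nhds (by linarith)))
  have hsymm : Filter.Tendsto e.symm (𝓝 (e p)) (𝓝 p) := e.tendsto_symm (mem_chart_source (Cn n) p)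
  obtain ⟨ρ, hρ, hρa⟩ := Metric.eventually_nhds_iff_ball.1 (hsymm.eventually hev)
  set R := min r ρ with hR
  have hRpos : 0 < R := lt_min hr hρ
  have hballR : Metric.ball (e p) R ⊆ Metric.ball (e p) r :=
    Metric.ball_subset_ball (min_le_left _ _)
  -- The neighbourhood is fixed before `s`, so it serves all sections at once. The Schwarz lemma on
  -- a third of the radius gains `1/9` in the square, the weight loses at most `2 * 2`, and `4/9 ≤
  -- 1/2`.
  refine ⟨e.source ∩ e ⁻¹' Metric.ball (e p) (R / 3),
    (e.isOpen_inter_preimage Metric.isOpen_ball).mem_nhds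
      ⟨mem_chart_source (Cn n) p, Metric.mem_ball_self (by positivity)⟩, ?_⟩
  intro s hs hsp C hC x hx
  set f : Cn n → ℂ := fun z => Q.frameCoeff m p (e.symm z) s with hf
  have hre : ∀ y ∈ t.baseSet, (Q.metric.pow m y (s y) (s y)).re =
      ‖Q.frameCoeff m p y s‖ ^ 2 * a y := by
    intro y hy
    rw [Q.pow_eq_frameCoeff hy, ← Complex.normSq_eq_conj_mul_self, ← Complex.ofReal_mul,
      Complex.ofReal_re, Complex.normSq_eq_norm_sq]
  have hC0 : 0 ≤ C := (Q.metric.pow_self_nonneg m p _).trans (hC p)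
  have hfp : f (e p) = 0 := by
    rw [hf]
    simp only [he, (chartAt (Cn n) p).left_inv (mem_chart_source (Cn n) p)]
    exact (Q.frameCoeff_eq_zero htp).2 hsp
  -- On the ball `‖f‖² a ≤ C` and `a > a p / 2`, hence `‖f‖² ≤ 2C / a p`.
  set B := Real.sqrt (2 * C / a p) with hB
  have hmaps : Set.MapsTo f (Metric.ball (e p) R) (Metric.closedBall (f (e p)) B) := by
    intro z hz
    rw [hfp, mem_closedBall_zero_iff]
    refine Real.le_sqrt_of_sq_le ?_
    have h1 := hC (e.symm z)
    rw [hre _ (hball (hballR hz)).2] at h1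
    have h2 := (hρa z (Metric.ball_subset_ball (min_le_right _ _) hz)).1
    rw [le_div_iff₀ hapos]
    have h3 : 0 ≤ ‖f z‖ ^ 2 := by positivity
    change ‖f z‖ ^ 2 * a (e.symm z) ≤ C at h1
    nlinarith
  have hx1 : e x ∈ Metric.ball (e p) R := Metric.ball_subset_ball (by linarith) hx.2
  have hsch := Complex.dist_le_div_mul_dist_of_mapsTo_ball
    (Q.differentiableOn_frameCoeff hs (hballR.trans hball)) hmaps hx1
  change dist (f (e x)) (f (e p)) ≤ _ at hsch
  have hsx : e.symm (e x) = x := e.left_inv hx.1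
  have hxb : x ∈ t.baseSet := hsx ▸ (hball (hballR hx1)).2
  have hax := (hρa _ (Metric.ball_subset_ball (min_le_right _ _) hx1)).2
  rw [hsx] at hax
  rw [hre x hxb]
  have hfx : f (e x) = Q.frameCoeff m p x s := by rw [hf]; simp only [hsx]
  rw [hfp, dist_zero_right, hfx] at hsch
  have hB0 : 0 ≤ B := Real.sqrt_nonneg _
  have hle : ‖Q.frameCoeff m p x s‖ ≤ B / 3 := by
    refine hsch.trans ?_
    have : dist (e x) (e p) ≤ R / 3 := (Metric.mem_ball.1 hx.2).le
    calc B / R * dist (e x) (e p) ≤ B / R * (R / 3) :=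
          mul_le_mul_of_nonneg_left this (by positivity)
      _ = B / 3 := by field_simp
  have hax0 : 0 ≤ a x := pow_nonneg (Q.metric.localRep_pos t hxb).le m
  have hB2 : B ^ 2 = 2 * C / a p := Real.sq_sqrt (by positivity)
  calc ‖Q.frameCoeff m p x s‖ ^ 2 * a x ≤ (B / 3) ^ 2 * (2 * a p) := by gcongr
    _ = 4 / 9 * C := by rw [div_pow, hB2]; field_simp; ring
    _ ≤ C / 2 := by linarith

/-- The space of global holomorphic sections of `L^m` is finite-dimensional. -/
theorem finiteDimensional_holSections (m : ℕ) : FiniteDimensional ℂ (Q.holSections m) := by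
  choose N hN hNle using Q.exists_nhds_pow_self_le m
  obtain ⟨P, -, hP⟩ := isCompact_univ.elim_nhds_subcover N fun p _ => hN p
  -- Evaluation at the centres of a finite subcover is injective: if `s` vanishes at all of them,
  -- the point where its squared norm is maximal lies in one of the neighbourhoods, so the maximum
  -- is at most half of itself.
  let ev : Q.holSections m →ₗ[ℂ] (P → ℂ) :=
    LinearMap.pi fun p => Q.frameCoeff m p.1 p.1 ∘ₗ (Q.holSections m).subtype
  refine FiniteDimensional.of_injective ev ((injective_iff_map_eq_zero ev).2 fun s hs => ?_)
  have hzero : ∀ p ∈ P, s.1 p = 0 := fun p hp =>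
    (Q.frameCoeff_eq_zero (mem_baseSet_trivializationAt ℂ L p)).1 (congrFun hs ⟨p, hp⟩)
  refine Subtype.ext (Q.section_ext_zero fun x => ?_)
  have hcont : Continuous fun x => (Q.metric.pow m x (s.1 x) (s.1 x)).re :=
    Complex.continuous_re.comp (Q.metric.continuous_pow s.1.2 s.1.2)
  obtain ⟨y, -, hy⟩ := isCompact_univ.exists_isMaxOn ⟨x, Set.mem_univ x⟩ hcont.continuousOn
  have hmax : ∀ x, _ ≤ (Q.metric.pow m y (s.1 y) (s.1 y)).re := fun x => hy (Set.mem_univ x)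
  obtain ⟨p, hp, hyp⟩ := Set.mem_iUnion₂.1 (hP (Set.mem_univ y))
  have h1 := hNle p s.1 s.2 (hzero p hp) _ hmax y hyp
  have h2 := Q.metric.pow_self_nonneg m x (s.1 x)
  have h3 := hmax x
  exact Q.metric.eq_zero_of_pow_self m x (by linarith)

end QuantumLineBundle

/-! ### Matrix elements, and polarization of pointwise relations -/

/-- An operator is the sum of its matrix elements in an orthonormal basis. -/
theorem sum_inner_smul_rankOne {H ι : Type*} [NormedAddCommGroup H] [InnerProductSpace ℂ H]
    [Fintype ι] (b : OrthonormalBasis ι ℂ H) (A : H →L[ℂ] H) :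
    ∑ i, ∑ j, (inner ℂ (b i) (A (b j))) • InnerProductSpace.rankOne ℂ (b i) (b j) = A := by
  ext t
  simp only [sum_apply, smul_apply,
    InnerProductSpace.rankOne_apply]
  rw [Finset.sum_comm]
  conv_rhs => rw [← b.sum_repr' t, map_sum]
  refine Finset.sum_congr rfl fun j _ => ?_
  rw [map_smul, ← b.sum_repr' (A (b j)), Finset.smul_sum]
  refine Finset.sum_congr rfl fun i _ => ?_
  rw [b.sum_repr' (A (b j)), smul_comm]

namespace QuantumLineBundle

variable {κ : KaehlerForm n M} [CompactSpace M] [T2Space M] [MeasurableSpace M] [BorelSpace M]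
  [IsManifold 𝓘(ℂ, Cn n) ω M]

variable (Q : QuantumLineBundle L κ) (m : ℕ)

/-- If `∑ᵢ h(sᵢ, tᵢ) = 0` pointwise on `M` for holomorphic sections `sᵢ`, `tᵢ` of `L^m`, then
`∑ᵢ conj(sᵢ(p)) tᵢ = 0` for each point `p`, with `sᵢ(p)` read in the local frame at `p`. -/
theorem sum_conj_frameCoeff_smul_eq_zero [ConnectedSpace M] {ι : Type*} [Fintype ι]
    (s t : ι → Q.holSections m)
    (h : ∀ x, ∑ i, Q.metric.pow m x ((s i).1 x) ((t i).1 x) = 0) (p : M) :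
    ∑ i, conj (Q.frameCoeff m p p (s i).1) • t i = 0 := by
  obtain ⟨r, hr, hball⟩ := exists_coordBall n L p
  set e := chartAt (Cn n) p with he
  have hpe : p ∈ e.source := mem_chart_source (Cn n) p
  have hpol := fun z (hz : z ∈ Metric.ball (e p) r) => sum_conj_center_mul_eq_zero
    (f := fun i z => Q.frameCoeff m p (e.symm z) (t i).1)
    (g := fun i z => Q.frameCoeff m p (e.symm z) (s i).1)
    (fun i => Q.differentiableOn_frameCoeff (t i).2 hball)
    (fun i => Q.differentiableOn_frameCoeff (s i).2 hball)
    (by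
      intro z hz
      have hb := (hball hz).2
      have h1 := h (e.symm z)
      simp only [Q.pow_eq_frameCoeff hb, ← Finset.sum_mul] at h1
      -- The positive factor `ĥ^m`, which is not holomorphic, is common to all terms and cancels.
      refine (mul_eq_zero.1 h1).resolve_right ?_
      exact_mod_cast pow_ne_zero m (Q.metric.localRep_pos _ hb).ne') hz
  -- Polarization only gives the relation in a coordinate ball around `p`; the identity theorem
  -- makes it global.
  refine Subtype.ext (Q.eq_zero_of_eventually_eq_zero (Submodule.coe_mem _) (p := p) ?_)
  filter_upwards [(e.isOpen_inter_preimage Metric.isOpen_ball).mem_nhds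
      (show p ∈ e.source ∩ e ⁻¹' Metric.ball (e p) r from ⟨hpe, Metric.mem_ball_self hr⟩)]
    with x hx
  have hb := (hball hx.2).2
  rw [Set.mem_preimage, e.left_inv hx.1] at hb
  refine (Q.frameCoeff_eq_zero hb).1 ?_
  have := hpol (e x) hx.2
  simp only [e.left_inv hx.1, e.left_inv hpe] at this
  simpa using this

/-! ### Coherent projectors and their integral against a function -/

section operators
variable [FiniteDimensional ℂ (Q.holSections m)]

theorem inner_coherentVector_fibreForm (x : M) (s : Q.holSections m) :
    inner ℂ (Q.coherentVector m x (fibreForm x)) s = Q.frameCoeff m x x s.1 :=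
  Q.inner_coherentVector m x _ s

theorem epsilon_nonneg (x : M) : 0 ≤ Q.epsilon m x :=
  div_nonneg (Q.metric.pow_self_nonneg m x _) (inner_self_nonneg (𝕜 := ℂ))

/-- The matrix elements of `ε(x) P_x` are the pointwise scalar products of sections. -/
theorem epsilon_mul_inner_coherentProjector (x : M) (s t : Q.holSections m) :
    (Q.epsilon m x : ℂ) * inner ℂ s (Q.coherentProjector m x t) =
      Q.metric.pow m x (s.1 x) (t.1 x) := by
  have hx := mem_baseSet_trivializationAt ℂ L x
  set c := Q.coherentVector m x (fibreForm x) with hc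
  have hcs : ∀ s : Q.holSections m, Q.frameCoeff m x x s.1 = inner ℂ c s := fun s =>
    (Q.inner_coherentVector_fibreForm m x s).symm
  have hreal : inner ℂ c c = ((inner ℂ c c : ℂ).re : ℂ) := (inner_self_ofReal_re (𝕜 := ℂ) c).symm
  have hP : inner ℂ s (Q.coherentProjector m x t) =
      (inner ℂ c c)⁻¹ * (inner ℂ c t * conj (inner ℂ c s)) := by
    rw [coherentProjector, ← hc, smul_apply, InnerProductSpace.rankOne_apply,
      inner_smul_right, inner_smul_right, inner_conj_symm]
  -- The coefficient of `c` at `x` is `⟨c, c⟩` itself, so `ε(x) = ⟨c, c⟩ ĥ(x)^m`, which cancels the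
  -- normalization of `P_x`.
  rw [hP, Q.pow_eq_frameCoeff hx, hcs, hcs, epsilon, ← hc, Q.pow_eq_frameCoeff hx, hcs]
  by_cases h0 : c = 0
  -- If all holomorphic sections vanish at `x`, then `c = 0`. The conventions for division by zero
  -- make `ε(x)` and `P_x` zero, and the right side vanishes too.
  · simp [h0]
  have hne : (inner ℂ c c : ℂ) ≠ 0 := inner_self_ne_zero.2 h0
  have hne' : (((inner ℂ c c : ℂ).re : ℝ) : ℂ) ≠ 0 := hreal ▸ hne
  rw [hreal]
  simp only [Complex.ofReal_div, Complex.ofReal_re, Complex.conj_ofReal, ← Complex.ofReal_mul]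
  push_cast
  field_simp

/-- Continuity in `x` is not visible from the definitions, which divide by `⟨e_α, e_α⟩` and use a
frame that may jump with `x`. Here all dependence on `x` sits in the continuous functions
`h^{(m)}(b_i, b_j)`. -/
theorem epsilon_smul_coherentProjector_eq {ι : Type*} [Fintype ι]
    (b : OrthonormalBasis ι ℂ (Q.holSections m)) (x : M) :
    (Q.epsilon m x : ℂ) • Q.coherentProjector m x = ∑ i, ∑ j,
      (Q.metric.pow m x ((b i).1.val x) ((b j).1.val x)) •
        InnerProductSpace.rankOne ℂ (b i) (b j) := by
  rw [← sum_inner_smul_rankOne b ((Q.epsilon m x : ℂ) • Q.coherentProjector m x)]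
  refine Finset.sum_congr rfl fun i _ => Finset.sum_congr rfl fun j _ => ?_
  rw [smul_apply, inner_smul_right, epsilon_mul_inner_coherentProjector]

theorem continuous_epsilon_smul_coherentProjector :
    Continuous fun x => (Q.epsilon m x : ℂ) • Q.coherentProjector m x := by
  simp only [Q.epsilon_smul_coherentProjector_eq m (stdOrthonormalBasis ℂ (Q.holSections m))]
  exact continuous_finsetSum _ fun i _ => continuous_finsetSum _ fun j _ =>
    (Q.metric.continuous_pow (Subtype.prop _) (Subtype.prop _)).smul continuous_const

/-- Rawnsley's function is the trace of `ε(x) P_x`. -/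
theorem epsilon_eq_sum {ι : Type*} [Fintype ι]
    (b : OrthonormalBasis ι ℂ (Q.holSections m)) (x : M) :
    (Q.epsilon m x : ℂ) = ∑ i, Q.metric.pow m x ((b i).1.val x) ((b i).1.val x) := by
  simp only [← epsilon_mul_inner_coherentProjector, ← Finset.mul_sum]
  set c := Q.coherentVector m x (fibreForm x) with hc
  by_cases h0 : c = 0
  · simp [epsilon, ← hc, h0]
  have hne : (inner ℂ c c : ℂ) ≠ 0 := inner_self_ne_zero.2 h0
  -- For a nonzero coherent vector, `P_x` is a rank-one projector and has trace 1.
  have : ∑ i, inner ℂ (b i) (Q.coherentProjector m x (b i)) = 1 := by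
    simp only [coherentProjector, ← hc, smul_apply,
      InnerProductSpace.rankOne_apply, inner_smul_right, ← Finset.mul_sum,
      b.sum_inner_mul_inner, inv_mul_cancel₀ hne]
  rw [this, mul_one]

theorem continuous_epsilon : Continuous (Q.epsilon m) := by
  have : Continuous fun x => (Q.epsilon m x : ℂ) := by
    simp only [Q.epsilon_eq_sum m (stdOrthonormalBasis ℂ (Q.holSections m))]
    exact continuous_finsetSum _ fun i _ =>
      Q.metric.continuous_pow (Subtype.prop _) (Subtype.prop _)
  exact Complex.continuous_re.comp this

/-- Matrix elements of a Toeplitz operator. -/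
theorem inner_toeplitz (f : C^∞⟮𝓘(ℝ, Cn n), M; 𝓘(ℝ, ℂ), ℂ⟯) (s t : Q.holSections m) :
    inner ℂ s (Q.toeplitz m f t) =
      ∫ x, f x * Q.metric.pow m x (s.1 x) (t.1 x) ∂κ.liouville := by
  have h1 : inner ℂ s (Q.toeplitz m f t) = inner ℂ s.1 (Q.mulSmooth m f t.1) :=
    Submodule.inner_orthogonalProjectionOnto_eq_of_mem_left s _
  rw [h1, inner_eq]
  refine integral_congr_ae (Filter.Eventually.of_forall fun x => ?_)
  have h2 : (Q.mulSmooth m f t.1).val x = f x • t.1.val x := rfl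
  simp only [h2, HermitianMetric.pow, HermitianMetric.powAt, map_smul, smul_eq_mul]
  ring

/-- `f` is a contravariant symbol of the Toeplitz operator `T_f`. -/
theorem isContravariantSymbol_toeplitz (f : C^∞⟮𝓘(ℝ, Cn n), M; 𝓘(ℝ, ℂ), ℂ⟯) :
    Q.IsContravariantSymbol m (Q.toeplitz m f) f := by
  have hmeas : Measurable fun x => ENNReal.ofReal (Q.epsilon m x) :=
    ENNReal.measurable_ofReal.comp (Q.continuous_epsilon m).measurable
  have hfin : ∀ᵐ x ∂κ.liouville, ENNReal.ofReal (Q.epsilon m x) < ⊤ :=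
    Filter.Eventually.of_forall fun x => ENNReal.ofReal_lt_top
  -- The density `ε` is moved from the measure into the integrand, which becomes continuous on a
  -- compact space.
  have hsmul : (fun x => (ENNReal.ofReal (Q.epsilon m x)).toReal •
      (f x • Q.coherentProjector m x)) =
      fun x => f x • ((Q.epsilon m x : ℂ) • Q.coherentProjector m x) := by
    funext x
    rw [ENNReal.toReal_ofReal (Q.epsilon_nonneg m x), ← Complex.coe_smul, smul_comm]
  have hcont : Continuous fun x => f x • ((Q.epsilon m x : ℂ) • Q.coherentProjector m x) :=
    f.contMDiff.continuous.smul (Q.continuous_epsilon_smul_coherentProjector m)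
  have hint : Integrable (fun x => f x • ((Q.epsilon m x : ℂ) • Q.coherentProjector m x))
      κ.liouville :=
    hcont.integrable_of_hasCompactSupport (HasCompactSupport.of_compactSpace _)
  refine ⟨?_, ?_⟩
  · rw [modifiedMeasure, integrable_withDensity_iff_integrable_smul' hmeas hfin, hsmul]
    exact hint
  · rw [modifiedMeasure, integral_withDensity_eq_integral_toReal_smul hmeas hfin, hsmul]
    refine ContinuousLinearMap.ext fun t => ext_inner_left ℂ fun s => ?_
    -- The matrix element `A ↦ ⟨s, A t⟩` is a continuous functional, so it commutes with the
    -- operator-valued integral.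
    let ℓ : (Q.holSections m →L[ℂ] Q.holSections m) →L[ℂ] ℂ :=
      innerSL ℂ s ∘L ContinuousLinearMap.apply ℂ (Q.holSections m) t
    have : CompleteSpace (Q.holSections m) := FiniteDimensional.complete ℂ _
    have hℓ := ℓ.integral_comp_comm hint
    change _ = ℓ (∫ x, _ ∂κ.liouville)
    rw [← hℓ]
    refine (Q.inner_toeplitz m f s t).trans
      (integral_congr_ae (Filter.Eventually.of_forall fun x => ?_))
    change _ = inner ℂ s (f x • (Q.epsilon m x : ℂ) • Q.coherentProjector m x t)
    rw [inner_smul_right, inner_smul_right, epsilon_mul_inner_coherentProjector]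

end operators

end QuantumLineBundle

/-! ### Surjectivity of the Toeplitz map by duality -/

/-- A smooth function orthogonal to all smooth functions vanishes. -/
theorem KaehlerForm.eq_zero_of_integral_mul_eq_zero {u : M → ℂ}
    [CompactSpace M] [T2Space M] [MeasurableSpace M] [BorelSpace M]
    [IsManifold 𝓘(ℂ, Cn n) ω M] (κ : KaehlerForm n M) (hu : ContMDiff 𝓘(ℝ, Cn n) 𝓘(ℝ, ℂ) ∞ u)
    (h : ∀ f : C^∞⟮𝓘(ℝ, Cn n), M; 𝓘(ℝ, ℂ), ℂ⟯, ∫ x, f x * u x ∂κ.liouville = 0) (x : M) :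
    u x = 0 := by
  -- Testing against `conj u` gives `∫ |u|² Ω = 0`, and the Liouville measure charges every nonempty
  -- open set.
  have h1 := h ⟨fun x => conj (u x), Complex.conjCLE.contDiff.contMDiff.comp hu⟩
  have h2 : ∫ x, ((Complex.normSq (u x) : ℝ) : ℂ) ∂κ.liouville = 0 := by
    rw [← h1]
    exact integral_congr_ae (Filter.Eventually.of_forall fun x =>
      Complex.normSq_eq_conj_mul_self)
  have h3 : ∫ x, Complex.normSq (u x) ∂κ.liouville = 0 :=
    Complex.ofReal_injective ((integral_ofReal (𝕜 := ℂ)).symm.trans h2)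
  by_contra hx
  exact (Continuous.integral_pos_of_hasCompactSupport_nonneg_nonzero (μ := κ.liouville)
    (Complex.continuous_normSq.comp hu.continuous) (HasCompactSupport.of_compactSpace _)
    (fun x => Complex.normSq_nonneg _) fun h0 => hx (Complex.normSq_eq_zero.1 h0)).ne' h3

namespace QuantumLineBundle

variable {κ : KaehlerForm n M} [CompactSpace M] [T2Space M] [MeasurableSpace M] [BorelSpace M]
  [IsManifold 𝓘(ℂ, Cn n) ω M]

variable (Q : QuantumLineBundle L κ) (m : ℕ)

/-- The functions `h(bᵢ, bⱼ)`, for a basis `b` of the holomorphic sections, are linearly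
independent. -/
theorem eq_zero_of_sum_mul_pow_eq_zero [ConnectedSpace M] {ι : Type*} [Fintype ι]
    {b : ι → Q.holSections m} (hb : LinearIndependent ℂ b) {a : ι → ι → ℂ}
    (h : ∀ x, ∑ i, ∑ j, a i j * Q.metric.pow m x ((b i).1.val x) ((b j).1.val x) = 0) (i j : ι) :
    a i j = 0 := by
  have key : ∀ p j, ∑ i, conj (Q.frameCoeff m p p (b i).1) * a i j = 0 := by
    intro p j
    -- The double sum is grouped as `∑ᵢ h(bᵢ, tᵢ)` with `tᵢ = ∑ⱼ a i j • b j`. Polarization then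
    -- gives a linear relation among the `b j`, whose coefficients vanish by independence.
    have h1 := Q.sum_conj_frameCoeff_smul_eq_zero m b (fun i => ∑ j, a i j • b j) (fun x => by
      have hx := mem_baseSet_trivializationAt ℂ L x
      rw [← h x]
      refine Finset.sum_congr rfl fun i _ => ?_
      simp only [Q.pow_eq_frameCoeff hx, Submodule.coe_sum, Submodule.coe_smul, map_sum, map_smul,
        smul_eq_mul, Finset.mul_sum, Finset.sum_mul]
      exact Finset.sum_congr rfl fun j _ => by ring) p
    simp only [Finset.smul_sum, smul_smul] at h1
    rw [Finset.sum_comm] at h1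
    simp only [← Finset.sum_smul] at h1
    exact Fintype.linearIndependent_iff.1 hb _ h1 j
  -- Now `p` varies: the conjugate of `key p j` says that this section vanishes at `p`, and
  -- independence is used a second time.
  have hsec : ∑ i, conj (a i j) • b i = 0 := by
    refine Subtype.ext (Q.section_ext_zero fun p => ?_)
    refine (Q.frameCoeff_eq_zero (mem_baseSet_trivializationAt ℂ L p)).1 ?_
    have := congrArg conj (key p j)
    simp only [map_sum, map_mul, Complex.conj_conj, map_zero] at this
    rw [← this]
    simp only [Submodule.coe_sum, Submodule.coe_smul, map_sum, map_smul, smul_eq_mul]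
    exact Finset.sum_congr rfl fun i _ => mul_comm _ _
  simpa using Fintype.linearIndependent_iff.1 hb _ hsec i

section operators
variable [FiniteDimensional ℂ (Q.holSections m)]

/-- The subspace of Toeplitz operators. -/
noncomputable def toeplitzOperators : Submodule ℂ (Module.End ℂ (Q.holSections m)) where
  carrier := Set.range (Q.toeplitz m)
  zero_mem' := by
    refine ⟨0, ?_⟩
    have : Q.mulSmooth m 0 = 0 :=
      LinearMap.ext fun s => Subtype.ext (funext fun x => zero_smul ℂ (s x))
    simp [toeplitz, this]
  add_mem' := by
    rintro _ _ ⟨f, rfl⟩ ⟨g, rfl⟩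
    refine ⟨f + g, ?_⟩
    have : Q.mulSmooth m (f + g) = Q.mulSmooth m f + Q.mulSmooth m g :=
      LinearMap.ext fun s => Subtype.ext (funext fun x => add_smul (f x) (g x) (s x))
    simp [toeplitz, this, LinearMap.add_comp, LinearMap.comp_add]
  smul_mem' := by
    rintro c _ ⟨f, rfl⟩
    refine ⟨⟨fun x => c * f x, (contDiff_const.mul contDiff_id).contMDiff.comp f.contMDiff⟩, ?_⟩
    have : Q.mulSmooth m ⟨fun x => c * f x,
        (contDiff_const.mul contDiff_id).contMDiff.comp f.contMDiff⟩ = c • Q.mulSmooth m f :=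
      LinearMap.ext fun s => Subtype.ext (funext fun x => mul_smul c (f x) (s x))
    simp [toeplitz, this, LinearMap.smul_comp, LinearMap.comp_smul]

/-- Every operator on the holomorphic sections is a Toeplitz operator. -/
theorem toeplitz_surjective [ConnectedSpace M] : Function.Surjective (Q.toeplitz m) := by
  suffices htop : Q.toeplitzOperators m = ⊤ from fun A => by
    have hA : A ∈ Q.toeplitzOperators m := htop ▸ Submodule.mem_top
    exact hA
  by_contra hne
  -- A proper subspace is contained in the kernel of a nonzero functional; `a` records its values on
  -- the rank-one operators.
  obtain ⟨φ, hφ0, hφ⟩ := Submodule.exists_le_ker_of_lt_top _ (lt_top_iff_ne_top.2 hne)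
  set b := stdOrthonormalBasis ℂ (Q.holSections m)
  set a : _ → _ → ℂ := fun i j =>
    φ (InnerProductSpace.rankOne ℂ (b i) (b j) : Q.holSections m →L[ℂ] Q.holSections m).toLinearMap
    with ha
  have hφA : ∀ A : Module.End ℂ (Q.holSections m),
      φ A = ∑ i, ∑ j, a i j * inner ℂ (b i) (A (b j)) := by
    intro A
    have h1 := congrArg ContinuousLinearMap.toLinearMap
      (sum_inner_smul_rankOne b (LinearMap.toContinuousLinearMap A))
    conv_lhs => rw [show A = (LinearMap.toContinuousLinearMap A).toLinearMap from rfl, ← h1]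
    simp only [ContinuousLinearMap.toLinearMap_sum, ContinuousLinearMap.toLinearMap_smul, map_sum,
      map_smul, smul_eq_mul, ha]
    exact Finset.sum_congr rfl fun i _ => Finset.sum_congr rfl fun j _ => mul_comm _ _
  set u : M → ℂ := fun x =>
    ∑ i, ∑ j, a i j * Q.metric.pow m x ((b i).1.val x) ((b j).1.val x) with hu
  have hpow : ∀ i j, ContMDiff 𝓘(ℝ, Cn n) 𝓘(ℝ, ℂ) ∞
      fun x => Q.metric.pow m x ((b i).1.val x) ((b j).1.val x) := fun i j =>
    Q.metric.contMDiff_pow (b i).1.2 (b j).1.2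
  have husm : ContMDiff 𝓘(ℝ, Cn n) 𝓘(ℝ, ℂ) ∞ u :=
    contMDiff_finsetSum fun i _ => contMDiff_finsetSum fun j _ =>
      (contDiff_const.mul contDiff_id).contMDiff.comp (hpow i j)
  -- By the matrix elements of `T_f`, `φ(T_f) = ∫ f u Ω`, so the vanishing of `φ` on Toeplitz
  -- operators makes `u` orthogonal to all smooth functions.
  have hu0 := κ.eq_zero_of_integral_mul_eq_zero husm fun f => by
    have hT : φ (Q.toeplitz m f) = 0 := hφ ⟨f, rfl⟩
    rw [hφA] at hT
    have hint : ∀ i j, Integrable (fun x => f x *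
        (a i j * Q.metric.pow m x ((b i).1.val x) ((b j).1.val x))) κ.liouville := fun i j =>
      (f.contMDiff.continuous.mul (continuous_const.mul (hpow i j).continuous)
        ).integrable_of_hasCompactSupport (HasCompactSupport.of_compactSpace _)
    simp only [hu, Finset.mul_sum]
    rw [integral_finsetSum _ fun i _ => integrable_finsetSum _ fun j _ => hint i j, ← hT]
    refine Finset.sum_congr rfl fun i _ => ?_
    rw [integral_finsetSum _ fun j _ => hint i j]
    refine Finset.sum_congr rfl fun j _ => ?_
    rw [inner_toeplitz, ← integral_const_mul]
    exact integral_congr_ae (Filter.Eventually.of_forall fun x => mul_left_comm _ _ _)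
  have ha0 := Q.eq_zero_of_sum_mul_pow_eq_zero m b.toBasis.linearIndependent (a := a)
    (by simpa [hu] using hu0)
  exact hφ0 (LinearMap.ext fun A => by simp [hφA, ha0])

end operators

end QuantumLineBundle

end BerezinToeplitz

/-- Finite-dimensionality is an existential witness because `toeplitz` and `IsContravariantSymbol`
take it as an instance. -/
theorem proposition5p5 {n : ℕ} {M : Type*} [TopologicalSpace M] [ChartedSpace (Cn n) M]
    [IsManifold 𝓘(ℂ, Cn n) ω M] [CompactSpace M] [T2Space M] [ConnectedSpace M]
    [MeasurableSpace M] [BorelSpace M]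
    {L : M → Type*} [∀ x, AddCommGroup (L x)] [∀ x, Module ℂ (L x)]
    [∀ x, TopologicalSpace (L x)] [TopologicalSpace (TotalSpace ℂ L)] [FiberBundle ℂ L]
    [VectorBundle ℂ ℂ L] [ContMDiffVectorBundle ω ℂ L 𝓘(ℂ, Cn n)]
    (κ : KaehlerForm n M) (Q : QuantumLineBundle L κ) (hL : VeryAmple n L) (m : ℕ) :
    ∃ _ : FiniteDimensional ℂ (Q.holSections m),
      (∀ f : C^∞⟮𝓘(ℝ, Cn n), M; 𝓘(ℝ, ℂ), ℂ⟯, Q.IsContravariantSymbol m (Q.toeplitz m f) f) ∧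
      ∀ A : Module.End ℂ (Q.holSections m),
        ∃ f : C^∞⟮𝓘(ℝ, Cn n), M; 𝓘(ℝ, ℂ), ℂ⟯, Q.IsContravariantSymbol m A f := by
  have hfin := Q.finiteDimensional_holSections m
  refine ⟨hfin, Q.isContravariantSymbol_toeplitz m, fun A => ?_⟩
  obtain ⟨f, rfl⟩ := Q.toeplitz_surjective m A
  exact ⟨f, Q.isContravariantSymbol_toeplitz m f⟩
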